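/- Let $1\le d<n$ be integers. Let $\mathrm{Gr}(d,n)$ be the Grassmannian of $d$-dimensional linear subspaces of $\mathbb R^n$, with the metric $\mathsf d(\sigma,\tau)=\sup_{|v|=1}|\Pi_\sigma v-\Pi_\tau v|$ ($\Pi_\sigma$ denoting the orthogonal projection onto $\sigma$) and with the rotation invariant probability measure $\mathrm d\sigma$, that is, the image of the Haar probability measure of $O(n)$ under $\omega\mapsto\omega(\mathrm{span}(e_1,\dots,e_d))$. For $\delta>0$ and $\sigma\in\mathrm{Gr}(d,n)$ let $$T_\delta(\sigma)=\{\xi\in\mathbb R^n:\ |\Pi_\sigma\xi|\le 1,\ |\Pi_{\sigma^\perp}\xi|<\delta\},\qquad \mathcal K_\delta f(\sigma)=\sup_{x\in\mathbb R^n}\frac1{|T_\delta(\sigma)|}\int_{x+T_\delta(\sigma)}|f(y)|\,\mathrm dy .$$ Then there is a constant $C>0$ depending only on $d$ and $n$ such that, for every $f\in L^2(\mathbb R^n)$, the function $\mathcal K_\delta f$ is measurable and - if $2d>n$, then $\|\mathcal K_\delta f\|_{L^2(\mathrm{Gr}(d,n))}\le C\,\|f\|_{L^2(\mathbb R^n)}$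 for all $0<\delta<1$; - if $2d=n$, then $\|\mathcal K_\delta f\|_{L^2(\mathrm{Gr}(d,n))}\le C\log(1/\delta)\,\|f\|_{L^2(\mathbb R^n)}$ for all $0<\delta\le \frac12$; - if $2d<n$, then $\|\mathcal K_\delta f\|_{L^2(\mathrm{Gr}(d,n))}\le C\,\delta^{d-\frac n2}\,\|f\|_{L^2(\mathbb R^n)}$ for all $0<\delta<1$. Moreover, if $2d>n$, there are no $(d,n)$-Besicovitch sets: there is no Borel set $A\subset\mathbb R^n$ of Lebesgue measure zero such that for every $\sigma\in\mathrm{Gr}(d,n)$ there is $y\in\mathbb R^n$ with $B_n(y,1)\cap(\sigma+y)\subset A$, where $B_n(y,1)$ is the open unit ball centred at $y$. -/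

import Mathlib

open MeasureTheory Set
open scoped ENNReal Pointwise

namespace KakeyaGr

noncomputable section

/-- Euclidean space `ℝⁿ`. -/
abbrev E (n : ℕ) : Type := EuclideanSpace ℝ (Fin n)

/-- The orthogonal group `O(n)`, as the group of unitary elements of the algebra of (continuous)
linear maps of `ℝⁿ`, with the topology of the operator norm. -/
abbrev O (n : ℕ) : Type := unitary (E n →L[ℝ] E n)

instance instContinuousStarOp (n : ℕ) : ContinuousStar (E n →L[ℝ] E n) :=
  ⟨(ContinuousLinearMap.adjoint (𝕜 := ℝ) (E := E n) (F := E n)).continuous⟩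

/-- The Grassmannian of `d`-dimensional linear subspaces of `ℝⁿ`. -/
def Gr (d n : ℕ) : Type := {σ : Submodule ℝ (E n) // Module.finrank ℝ σ = d}

/-- The orthogonal projection onto `σ`, as an operator on `ℝⁿ`. -/
def Gr.proj {d n : ℕ} (σ : Gr d n) : E n →L[ℝ] E n := σ.1.starProjection

/-- The orthogonal projection onto `σ^⊥`, as an operator on `ℝⁿ`. -/
def Gr.projPerp {d n : ℕ} (σ : Gr d n) : E n →L[ℝ] E n := σ.1ᗮ.starProjection

theorem Gr.proj_injective {d n : ℕ} : Function.Injective (Gr.proj : Gr d n → _) := by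
  intro σ τ h
  exact Subtype.ext (Submodule.starProjection_inj.1 h)

/-- The metric `d(σ, τ) = sup_{|v| = 1} |Π_σ v - Π_τ v|`. -/
instance instMetricSpaceGr (d n : ℕ) : MetricSpace (Gr d n) :=
  MetricSpace.induced Gr.proj Gr.proj_injective inferInstance

instance instMeasurableSpaceGr (d n : ℕ) : MeasurableSpace (Gr d n) := borel _

instance instBorelSpaceGr (d n : ℕ) : BorelSpace (Gr d n) := ⟨rfl⟩

/-- The span of the first `d` canonical vectors of `ℝⁿ`. -/
def stdSubspace {d n : ℕ} (h : d ≤ n) : Submodule ℝ (E n) :=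
  Submodule.span ℝ (range fun i : Fin d => EuclideanSpace.single (Fin.castLE h i) (1 : ℝ))

theorem finrank_stdSubspace {d n : ℕ} (h : d ≤ n) :
    Module.finrank ℝ (stdSubspace h) = d := by
  have hl : LinearIndependent ℝ
      (fun i : Fin d => (EuclideanSpace.single (Fin.castLE h i) (1 : ℝ) : E n)) := by
    have h1 := (EuclideanSpace.orthonormal_single (ι := Fin n) (𝕜 := ℝ)).linearIndependent
    exact h1.comp _ (Fin.castLE_injective h)
  exact (finrank_span_eq_card hl).trans (Fintype.card_fin d)

/-- The subspace `ω (span (e₁, …, e_d))`, for `ω ∈ O(n)`. -/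
def rot {d n : ℕ} (h : d ≤ n) (ω : O n) : Gr d n :=
  ⟨(stdSubspace h).map ((Unitary.linearIsometryEquiv ω).toLinearEquiv : E n →ₗ[ℝ] E n), by
    rw [LinearEquiv.finrank_map_eq, finrank_stdSubspace]⟩

theorem continuous_rot {d n : ℕ} (h : d ≤ n) : Continuous (rot h) := by
  refine continuous_induced_rng.2 ?_
  have key : (Gr.proj ∘ rot h : O n → _) =
      fun ω : O n => (ω : E n →L[ℝ] E n) * (stdSubspace h).starProjection *
        ((star ω : O n) : E n →L[ℝ] E n) := by
    funext ω
    ext1 x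
    exact Submodule.starProjection_map_apply (Unitary.linearIsometryEquiv ω) (stdSubspace h) x
  rw [key]
  exact (continuous_subtype_val.mul continuous_const).mul
    (continuous_subtype_val.comp continuous_star)

instance instCompactSpaceO (n : ℕ) : CompactSpace (O n) := by
  refine isCompact_iff_compactSpace.1 ?_
  refine Metric.isCompact_of_isClosed_isBounded isClosed_unitary ?_
  refine (Metric.isBounded_closedBall (x := (0 : E n →L[ℝ] E n)) (r := 1)).subset ?_
  intro u hu
  rw [mem_closedBall_zero_iff]
  refine ContinuousLinearMap.opNorm_le_bound _ zero_le_one fun x => ?_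
  rw [one_mul]
  exact ((Unitary.linearIsometryEquiv ⟨u, hu⟩).norm_map x).le

/-- The Haar probability measure on `O(n)`. -/
def haarO (n : ℕ) : Measure (O n) := Measure.haarMeasure ⊤

instance instIsProbabilityMeasureHaarO (n : ℕ) : IsProbabilityMeasure (haarO n) :=
  ⟨Measure.haarMeasure_self (K₀ := (⊤ : TopologicalSpace.PositiveCompacts (O n)))⟩

/-- The rotation invariant probability measure `dσ` on `Gr(d,n)`: the image of the Haar
probability measure of `O(n)` under `ω ↦ ω (span (e₁, …, e_d))`. -/
def grMeasure {d n : ℕ} (h : d ≤ n) : Measure (Gr d n) := (haarO n).map (rot h)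

instance instIsProbabilityMeasureGrMeasure {d n : ℕ} (h : d ≤ n) :
    IsProbabilityMeasure (grMeasure h) :=
  Measure.isProbabilityMeasure_map (continuous_rot h).measurable.aemeasurable

/-- The `δ`-plate `T_δ(σ) = {ξ : |Π_σ ξ| ≤ 1, |Π_{σ^⊥} ξ| < δ}`. -/
def plate {d n : ℕ} (δ : ℝ) (σ : Gr d n) : Set (E n) :=
  {ξ | ‖σ.proj ξ‖ ≤ 1 ∧ ‖σ.projPerp ξ‖ < δ}

/-- The `(d,n)`-Kakeya maximal function: the supremum over `x ∈ ℝⁿ` of the average of `|f|` over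
`x + T_δ(σ)`. -/
def kakeya {d n : ℕ} (δ : ℝ) (f : E n → ℂ) (σ : Gr d n) : ℝ≥0∞ :=
  ⨆ x : E n, ⨍⁻ y in x +ᵥ plate δ σ, ‖f y‖ₑ ∂volume

/-- `K_δ` maps `L²(ℝⁿ)` to `L²(Gr(d,n))` with norm at most `B`. -/
def KakeyaNormLE {d n : ℕ} (h : d ≤ n) (δ B : ℝ) : Prop :=
  ∀ f : E n → ℂ, MemLp f 2 volume →
    AEStronglyMeasurable (kakeya (d := d) δ f) (grMeasure h) ∧
      eLpNorm (kakeya (d := d) δ f) 2 (grMeasure h) ≤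
        ENNReal.ofReal B * eLpNorm f 2 volume

/-- A Borel set is a `(d,n)`-set if it contains a translate of the unit ball of every
`d`-dimensional subspace of `ℝⁿ`. -/
def IsPlaneSet (d n : ℕ) (A : Set (E n)) : Prop :=
  MeasurableSet A ∧
    ∀ σ : Gr d n, ∃ y : E n, Metric.ball y 1 ∩ (y +ᵥ (σ.1 : Set (E n))) ⊆ A

/-- A `(d,n)`-Besicovitch set is a `(d,n)`-set of Lebesgue measure zero. -/
def IsBesicovitch (d n : ℕ) (A : Set (E n)) : Prop :=
  IsPlaneSet d n A ∧ volume A = 0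

end

end KakeyaGr

/-! The maximal function is majorized on the Fourier side. Put F = |f|. The indicator of a δ-plate
is dominated by a Gaussian adapted to the plate. That Gaussian is, up to a determinant, the Fourier
transform of g_σ(ξ) = exp(-π(|Π_σ ξ|² + δ²|Π_{σ^⊥} ξ|²)), which is concentrated on the dual plate. A
translation changes only the phase of the transform of F, so the supremum over x costs nothing and
K_δ f(σ) ≤ c ∫ g_σ |F̂| (`laverage_plate_le`).

The mean of g_σ over σ is at most w(ξ) = C (1+|ξ|)^{-d} exp(-πδ²|ξ|²/2), by `exists_meanGaussian_le`
and `lintegral_plateGaussian_rot_le`. Cauchy-Schwarz gives (∫ g_σ|F̂|)² ≤ (∫ g_σ|F̂|²/w)(∫ g_σ w).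
Since w is radial, the last factor does not depend on σ, hence equals its own mean, which is at most
∫ w². The mean of the first factor is at most ∫ |F̂|² ≤ ∫ |f|². This is
`lintegral_sq_lintegral_mul_le` followed by Plancherel.

So the squared operator norm is controlled by ∫ w², that is by ∫ y^{n-1} (1+y)^{-2d} exp(-πδ²y²) dy
over y > 0, and the three regimes are the three behaviours of this integral as δ → 0.

If the bound is uniform in δ, test it on the indicator of a small open neighbourhood U of a null set
A containing unit discs in all directions: K_δ is at least 2^{-n} for small δ, for each σ, and
Fatou's lemma contradicts the smallness of U. -/

namespace KakeyaGr

/-! ### Fourier transform and the Plancherel inequality -/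

section Fourier

open scoped FourierTransform ComplexConjugate RealInnerProductSpace

variable {V : Type*} [NormedAddCommGroup V] [InnerProductSpace ℝ V] [FiniteDimensional ℝ V]
  [MeasurableSpace V] [BorelSpace V]

theorem integral_fourier_mul_eq {f g : V → ℂ} (hf : Integrable f) (hg : Integrable g) :
    ∫ ξ, 𝓕 f ξ * g ξ = ∫ x, f x * 𝓕 g x := by
  have h := VectorFourier.integral_fourierIntegral_smul_eq_flip (μ := volume) (ν := volume)
    (L := innerₗ V) Real.continuous_fourierChar continuous_inner hf hg
  simpa using! h

/-- A translation only multiplies the transform by a phase; this is what removes the supremum over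
centres in the maximal function. -/
theorem norm_fourier_comp_add_right (f : V → ℂ) (x ξ : V) :
    ‖𝓕 (fun v => f (v + x)) ξ‖ = ‖𝓕 f ξ‖ := by
  have h := congrFun (VectorFourier.fourierIntegral_comp_add_right Real.fourierChar volume
    (innerₗ V) f x) ξ
  have h' : 𝓕 (fun v => f (v + x)) ξ = Real.fourierChar (innerₗ V x ξ) • 𝓕 f ξ := h
  rw [h', Circle.norm_smul]

theorem fourier_conj_neg (f : V → ℂ) (ξ : V) :
    𝓕 (fun x => conj (f (-x))) ξ = conj (𝓕 f ξ) := by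
  rw [Real.fourier_eq, Real.fourier_eq, ← integral_conj,
    ← integral_neg_eq_self]
  refine integral_congr_ae (.of_forall fun x => ?_)
  simp [Circle.smul_def, Real.fourierChar_apply, ← Complex.exp_conj, Complex.conj_ofNat]

theorem integrable_gaussian {b : ℝ} (hb : 0 < b) :
    Integrable fun v : V => Real.exp (-b * ‖v‖ ^ 2) := by
  have h := (GaussianFourier.integrable_cexp_neg_mul_sq_norm_add (V := V) (b := b)
    (by simpa using hb) 0 0).norm
  refine h.congr (.of_forall fun v => ?_)
  simp [Complex.norm_exp, ← Complex.ofReal_pow]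

/-- The transform is a positive Gaussian of mass one for every b, which keeps the damped Plancherel
inequality uniform as b → 0. -/
theorem integral_norm_fourier_gaussian {b : ℝ} (hb : 0 < b) :
    Integrable (𝓕 (fun v : V => Complex.exp (-(b : ℂ) * ‖v‖ ^ 2))) ∧
    ∫ w : V, ‖𝓕 (fun v : V => Complex.exp (-(b : ℂ) * ‖v‖ ^ 2)) w‖ = 1 := by
  have hb' : 0 < Real.pi ^ 2 / b := by positivity
  have e1 : ∀ w : V, 𝓕 (fun v : V => Complex.exp (-(b : ℂ) * ‖v‖ ^ 2)) w =
      (((Real.pi / b) ^ (Module.finrank ℝ V / 2 : ℝ) *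
        Real.exp (-(Real.pi ^ 2 / b) * ‖w‖ ^ 2) : ℝ) : ℂ) := by
    intro w
    rw [fourier_gaussian_innerProductSpace (by simpa using hb)]
    rw [Complex.ofReal_mul, Complex.ofReal_cpow (by positivity)]
    push_cast
    congr 2
    ring
  have e2 := GaussianFourier.integral_rexp_neg_mul_sq_norm (V := V) hb'
  refine ⟨?_, ?_⟩
  · have : (𝓕 (fun v : V => Complex.exp (-(b : ℂ) * ‖v‖ ^ 2))) = fun w =>
      (((Real.pi / b) ^ (Module.finrank ℝ V / 2 : ℝ) *
        Real.exp (-(Real.pi ^ 2 / b) * ‖w‖ ^ 2) : ℝ) : ℂ) := funext e1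
    rw [this]
    exact ((integrable_gaussian hb').const_mul _).ofReal
  · simp_rw [e1, Complex.norm_real, Real.norm_eq_abs]
    have : ∀ w : V, |(Real.pi / b) ^ (Module.finrank ℝ V / 2 : ℝ) *
        Real.exp (-(Real.pi ^ 2 / b) * ‖w‖ ^ 2)| = (Real.pi / b) ^ (Module.finrank ℝ V / 2 : ℝ) *
        Real.exp (-(Real.pi ^ 2 / b) * ‖w‖ ^ 2) := fun w => abs_of_nonneg (by positivity)
    simp_rw [this]
    rw [integral_const_mul, e2, ← Real.mul_rpow (by positivity) (by positivity)]
    have : Real.pi / b * (Real.pi / (Real.pi ^ 2 / b)) = 1 := by field_simp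
    rw [this, Real.one_rpow]

/-- The autocorrelation of f is bounded by its value at the origin: 2ab ≤ a² + b² and translation
invariance. -/
theorem norm_integral_mul_conj_sub_le {f : V → ℂ} (hf2 : MemLp f 2 volume) (x : V) :
    ‖∫ t, f t * conj (f (-(x - t)))‖ ≤ ∫ t, ‖f t‖ ^ 2 := by
  have hi : Integrable fun t => ‖f t‖ ^ 2 := hf2.integrable_norm_pow (by norm_num)
  have hi' : Integrable fun t => ‖f (t - x)‖ ^ 2 := hi.comp_sub_right x
  calc ‖∫ t, f t * conj (f (-(x - t)))‖
      ≤ ∫ t, (‖f t‖ ^ 2 + ‖f (t - x)‖ ^ 2) / 2 := by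
        refine norm_integral_le_of_norm_le ((hi.add hi').div_const 2) (.of_forall fun t => ?_)
        rw [norm_mul, RCLike.norm_conj, neg_sub]
        nlinarith [sq_nonneg (‖f t‖ - ‖f (t - x)‖)]
    _ = ∫ t, ‖f t‖ ^ 2 := by
        rw [integral_div, integral_add hi hi', integral_sub_right_eq_self (fun t => ‖f t‖ ^ 2) x]
        ring

theorem continuous_fourier {f : V → ℂ} (hf : Integrable f) : Continuous (𝓕 f) :=
  VectorFourier.fourierIntegral_continuous Real.continuous_fourierChar
    (L := innerₗ V) continuous_inner hf

/-- The autocorrelation H has transform |𝓕 f|². Moving the transform from H onto the Gaussian G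
bounds the left side by sup|H| times the L¹ norm of 𝓕 G, which is one. -/
theorem integral_norm_sq_fourier_mul_gaussian_le {f : V → ℂ} (hf : Integrable f)
    (hf2 : MemLp f 2 volume) {b : ℝ} (hb : 0 < b) :
    ∫ ξ, ‖𝓕 f ξ‖ ^ 2 * Real.exp (-b * ‖ξ‖ ^ 2) ≤ ∫ t, ‖f t‖ ^ 2 := by
  set h : V → ℂ := fun x => conj (f (-x)) with hh
  have hhi : Integrable h := by
    have : Integrable fun x => f (-x) := hf.comp_neg
    exact (Complex.conjLIE.toContinuousLinearEquiv.toContinuousLinearMap.integrable_comp this)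
  set H : V → ℂ := MeasureTheory.convolution f h (ContinuousLinearMap.mul ℂ ℂ) volume with hH
  have hHi : Integrable H := hf.integrable_convolution _ hhi
  have hHb : ∀ x, ‖H x‖ ≤ ∫ t, ‖f t‖ ^ 2 := fun x => by
    rw [hH, convolution_def]
    exact norm_integral_mul_conj_sub_le hf2 x
  set G : V → ℂ := fun v => Complex.exp (-(b : ℂ) * ‖v‖ ^ 2) with hG
  have hGr : ∀ v, G v = ((Real.exp (-b * ‖v‖ ^ 2) : ℝ) : ℂ) := fun v => by simp [hG]
  have hGi : Integrable G := by
    rw [show G = _ from funext hGr]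
    exact (integrable_gaussian hb).ofReal
  obtain ⟨hgi, hg1⟩ := integral_norm_fourier_gaussian (V := V) hb
  have key := integral_fourier_mul_eq hHi hGi
  have e1 : ∀ ξ, 𝓕 H ξ * G ξ = ((‖𝓕 f ξ‖ ^ 2 * Real.exp (-b * ‖ξ‖ ^ 2) : ℝ) : ℂ) := fun ξ => by
    rw [hH, Real.fourier_mul_convolution_eq hf hhi, hh, fourier_conj_neg, hGr,
      Complex.mul_conj, Complex.normSq_eq_norm_sq, Complex.ofReal_mul]
  simp_rw [e1] at key
  rw [integral_complex_ofReal] at key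
  have hnn : 0 ≤ ∫ ξ, ‖𝓕 f ξ‖ ^ 2 * Real.exp (-b * ‖ξ‖ ^ 2) :=
    integral_nonneg fun ξ => by positivity
  calc ∫ ξ, ‖𝓕 f ξ‖ ^ 2 * Real.exp (-b * ‖ξ‖ ^ 2)
      = ‖((∫ ξ, ‖𝓕 f ξ‖ ^ 2 * Real.exp (-b * ‖ξ‖ ^ 2) : ℝ) : ℂ)‖ := by
        rw [Complex.norm_real, Real.norm_of_nonneg hnn]
    _ = ‖∫ x, H x * 𝓕 G x‖ := by rw [key]
    _ ≤ ∫ x, (∫ t, ‖f t‖ ^ 2) * ‖𝓕 G x‖ := by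
        refine norm_integral_le_of_norm_le (hgi.norm.const_mul _) (.of_forall fun x => ?_)
        rw [norm_mul]
        exact mul_le_mul_of_nonneg_right (hHb x) (norm_nonneg _)
    _ = ∫ t, ‖f t‖ ^ 2 := by rw [integral_const_mul, hg1, mul_one]

/-- The inequality in Plancherel's theorem, for integrable and square integrable functions. -/
theorem lintegral_enorm_sq_fourier_le {f : V → ℂ} (hf : Integrable f) (hf2 : MemLp f 2 volume) :
    ∫⁻ ξ, ‖𝓕 f ξ‖ₑ ^ 2 ≤ ∫⁻ x, ‖f x‖ₑ ^ 2 := by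
  have hc : Continuous (𝓕 f) := continuous_fourier hf
  have hi : Integrable fun t => ‖f t‖ ^ 2 := hf2.integrable_norm_pow (by norm_num)
  have e0 : ENNReal.ofReal (∫ t, ‖f t‖ ^ 2) = ∫⁻ x, ‖f x‖ₑ ^ 2 := by
    rw [ofReal_integral_eq_lintegral_ofReal hi (.of_forall fun x => by positivity)]
    refine lintegral_congr fun x => ?_
    rw [ENNReal.ofReal_pow (norm_nonneg _), ofReal_norm]
  let b : ℕ → ℝ := fun k => 1 / ((k : ℝ) + 1)
  have hb : ∀ k, 0 < b k := fun k => by positivity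
  have hbd : ∀ k, ∫⁻ ξ, ENNReal.ofReal (‖𝓕 f ξ‖ ^ 2 * Real.exp (-b k * ‖ξ‖ ^ 2))
      ≤ ∫⁻ x, ‖f x‖ₑ ^ 2 := fun k => by
    have hint : Integrable fun ξ => ‖𝓕 f ξ‖ ^ 2 * Real.exp (-b k * ‖ξ‖ ^ 2) := by
      refine ((integrable_gaussian (hb k)).const_mul ((∫ v, ‖f v‖) ^ 2)).mono'
        (by fun_prop) (.of_forall fun ξ => ?_)
      rw [Real.norm_of_nonneg (by positivity)]
      gcongr
      exact VectorFourier.norm_fourierIntegral_le_integral_norm _ _ (innerₗ V) f ξ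
    rw [← ofReal_integral_eq_lintegral_ofReal hint (.of_forall fun x => by positivity), ← e0]
    exact ENNReal.ofReal_le_ofReal (integral_norm_sq_fourier_mul_gaussian_le hf hf2 (hb k))
  -- The damping disappears as `b k` → 0, so Fatou's lemma carries the uniform bound to the limit.
  have hlim : ∀ ξ, ‖𝓕 f ξ‖ₑ ^ 2 = Filter.liminf (fun k =>
      ENNReal.ofReal (‖𝓕 f ξ‖ ^ 2 * Real.exp (-b k * ‖ξ‖ ^ 2))) Filter.atTop := fun ξ => by
    have ht : Filter.Tendsto (fun k => ENNReal.ofReal (‖𝓕 f ξ‖ ^ 2 * Real.exp (-b k * ‖ξ‖ ^ 2)))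
        Filter.atTop (nhds (ENNReal.ofReal (‖𝓕 f ξ‖ ^ 2 * Real.exp (-0 * ‖ξ‖ ^ 2)))) := by
      refine ENNReal.tendsto_ofReal (Filter.Tendsto.const_mul _ ?_)
      refine (Real.continuous_exp.tendsto _).comp ?_
      exact (tendsto_one_div_add_atTop_nhds_zero_nat.neg).mul_const _
    rw [ht.liminf_eq, neg_zero, zero_mul, Real.exp_zero, mul_one,
      ENNReal.ofReal_pow (norm_nonneg _), ofReal_norm]
  simp_rw [hlim]
  refine (lintegral_liminf_le fun k => by fun_prop).trans ?_
  refine Filter.liminf_le_of_frequently_le' (Filter.Frequently.of_forall hbd)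

end Fourier

end KakeyaGr

namespace KakeyaGr

/-! ### Anisotropic dilations, plate Gaussians, and averages over plates -/

section Dilation

open scoped FourierTransform RealInnerProductSpace

variable {V : Type*} [NormedAddCommGroup V] [InnerProductSpace ℝ V] [FiniteDimensional ℝ V]

/-- The linear map which is the identity on `K` and the multiplication by `c` on `Kᗮ`. -/
noncomputable def orthDilation (K : Submodule ℝ V) (c : ℝ) : V →L[ℝ] V :=
  K.starProjection + c • Kᗮ.starProjection

theorem orthDilation_apply (K : Submodule ℝ V) (c : ℝ) (x : V) :
    orthDilation K c x = K.starProjection x + c • Kᗮ.starProjection x := rfl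

theorem starProjection_orthDilation (K : Submodule ℝ V) (c : ℝ) (x : V) :
    K.starProjection (orthDilation K c x) = K.starProjection x := by
  have h1 : K.starProjection (K.starProjection x) = K.starProjection x :=
    Submodule.starProjection_eq_self_iff.2 (Submodule.starProjection_apply_mem K x)
  have h2 : K.starProjection (Kᗮ.starProjection x) = 0 :=
    (Submodule.starProjection_apply_eq_zero_iff (K := K)).2 (Submodule.starProjection_apply_mem _ x)
  rw [orthDilation_apply, map_add, map_smul, h1, h2, smul_zero, add_zero]

theorem starProjection_orthogonal_orthDilation (K : Submodule ℝ V) (c : ℝ) (x : V) :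
    Kᗮ.starProjection (orthDilation K c x) = c • Kᗮ.starProjection x := by
  have h1 : Kᗮ.starProjection (Kᗮ.starProjection x) = Kᗮ.starProjection x :=
    Submodule.starProjection_eq_self_iff.2 (Submodule.starProjection_apply_mem Kᗮ x)
  have h2 : Kᗮ.starProjection (K.starProjection x) = 0 :=
    (Submodule.starProjection_apply_eq_zero_iff (K := Kᗮ)).2
      (Submodule.le_orthogonal_orthogonal K (Submodule.starProjection_apply_mem _ x))
  rw [orthDilation_apply, map_add, map_smul, h1, h2, zero_add]

theorem orthDilation_orthDilation_inv (K : Submodule ℝ V) {c : ℝ} (hc : c ≠ 0) (x : V) :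
    orthDilation K c (orthDilation K c⁻¹ x) = x := by
  rw [orthDilation_apply, starProjection_orthDilation, starProjection_orthogonal_orthDilation,
    smul_smul, mul_inv_cancel₀ hc, one_smul, Submodule.starProjection_add_starProjection_orthogonal]

theorem norm_sq_orthDilation (K : Submodule ℝ V) (c : ℝ) (x : V) :
    ‖orthDilation K c x‖ ^ 2 = ‖K.starProjection x‖ ^ 2 + c ^ 2 * ‖Kᗮ.starProjection x‖ ^ 2 := by
  rw [Submodule.norm_sq_eq_add_norm_sq_starProjection _ K, starProjection_orthDilation,
    starProjection_orthogonal_orthDilation, norm_smul, mul_pow, Real.norm_eq_abs, sq_abs]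

theorem inner_orthDilation_left (K : Submodule ℝ V) (c : ℝ) (x y : V) :
    ⟪orthDilation K c x, y⟫ = ⟪x, orthDilation K c y⟫ := by
  rw [orthDilation_apply, orthDilation_apply, inner_add_left, inner_add_right, inner_smul_left,
    inner_smul_right, Submodule.inner_starProjection_left_eq_right,
    Submodule.inner_starProjection_left_eq_right]
  simp

theorem det_orthDilation_ne_zero (K : Submodule ℝ V) {c : ℝ} (hc : c ≠ 0) :
    LinearMap.det (orthDilation K c : V →ₗ[ℝ] V) ≠ 0 := by
  have h : (orthDilation K c : V →ₗ[ℝ] V) ∘ₗ (orthDilation K c⁻¹ : V →ₗ[ℝ] V) = LinearMap.id :=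
    LinearMap.ext fun x => orthDilation_orthDilation_inv K hc x
  have h2 := congrArg LinearMap.det h
  rw [LinearMap.det_comp, LinearMap.det_id] at h2
  exact left_ne_zero_of_mul_eq_one h2

/-- The Gaussian adapted to the plate dual to the `δ`-plate of `K`. -/
noncomputable def plateGaussian (K : Submodule ℝ V) (c : ℝ) (x : V) : ℝ :=
  Real.exp (-Real.pi * ‖orthDilation K c x‖ ^ 2)

theorem plateGaussian_pos (K : Submodule ℝ V) (c : ℝ) (x : V) : 0 < plateGaussian K c x :=
  Real.exp_pos _

theorem continuous_plateGaussian (K : Submodule ℝ V) (c : ℝ) : Continuous (plateGaussian K c) := by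
  unfold plateGaussian
  fun_prop

/-- On the plate both squared terms of the dilated norm are at most 1, so the Gaussian is at least
exp(-2π). -/
theorem one_le_plateGaussian (K : Submodule ℝ V) {c : ℝ} (hc : 0 < c) {ξ : V}
    (h1 : ‖K.starProjection ξ‖ ≤ 1) (h2 : ‖Kᗮ.starProjection ξ‖ < c) :
    1 ≤ Real.exp (2 * Real.pi) * plateGaussian K c⁻¹ ξ := by
  rw [plateGaussian, ← Real.exp_add]
  refine Real.one_le_exp ?_
  rw [norm_sq_orthDilation, ← mul_pow]
  have h3 : c⁻¹ * ‖Kᗮ.starProjection ξ‖ ≤ 1 := by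
    rw [inv_mul_le_iff₀ hc, mul_one]
    exact h2.le
  have h4 : ‖K.starProjection ξ‖ ^ 2 ≤ 1 := pow_le_one₀ (norm_nonneg _) h1
  have h5 : (c⁻¹ * ‖Kᗮ.starProjection ξ‖) ^ 2 ≤ 1 := pow_le_one₀ (by positivity) h3
  nlinarith [Real.pi_pos]

variable [MeasurableSpace V] [BorelSpace V]

theorem integral_comp_orthDilation (K : Submodule ℝ V) {c : ℝ} (hc : c ≠ 0) (f : V → ℂ) :
    ∫ x, f (orthDilation K c x) =
      ((|(LinearMap.det (orthDilation K c : V →ₗ[ℝ] V))|⁻¹ : ℝ) : ℂ) * ∫ x, f x := by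
  have hd := det_orthDilation_ne_zero K hc
  have hm := Measure.map_linearMap_addHaar_eq_smul_addHaar (volume : Measure V) hd
  let e := (LinearMap.equivOfDetNeZero _ hd).toContinuousLinearEquiv.toHomeomorph.toMeasurableEquiv
  have h := integral_map_equiv (μ := volume) e f
  have h3 : (⇑e : V → V) = orthDilation K c := rfl
  rw [h3] at h
  rw [← h]
  have h4 : Measure.map (orthDilation K c) (volume : Measure V) = _ := hm
  rw [h4, integral_smul_measure, ENNReal.toReal_ofReal (abs_nonneg _), abs_inv]
  simp

theorem lintegral_comp_orthDilation (K : Submodule ℝ V) {c : ℝ} (hc : c ≠ 0) (f : V → ℝ≥0∞) :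
    ∫⁻ x, f (orthDilation K c x) =
      ENNReal.ofReal |(LinearMap.det (orthDilation K c : V →ₗ[ℝ] V))|⁻¹ * ∫⁻ x, f x := by
  have hd := det_orthDilation_ne_zero K hc
  have hm := Measure.map_linearMap_addHaar_eq_smul_addHaar (volume : Measure V) hd
  let e := (LinearMap.equivOfDetNeZero _ hd).toContinuousLinearEquiv.toHomeomorph.toMeasurableEquiv
  have h := lintegral_map_equiv (μ := volume) f e
  have h3 : (⇑e : V → V) = orthDilation K c := rfl
  rw [h3] at h
  rw [← h]
  have h4 : Measure.map (orthDilation K c) (volume : Measure V) = _ := hm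
  rw [h4, lintegral_smul_measure, abs_inv, smul_eq_mul]

/-- The Gaussian exp(-π|v|²) is its own transform. Substituting v = Lξ, with L the dilation, moves
L⁻¹ to the frequency because L is self-adjoint. -/
theorem fourier_plateGaussian (K : Submodule ℝ V) {c : ℝ} (hc : c ≠ 0) (y : V) :
    𝓕 (fun ξ => (plateGaussian K c ξ : ℂ)) y =
      ((|(LinearMap.det (orthDilation K c : V →ₗ[ℝ] V))|⁻¹ * plateGaussian K c⁻¹ y : ℝ) : ℂ) := by
  have h0 := fourier_gaussian_innerProductSpace (V := V) (b := Real.pi)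
    (by simpa using Real.pi_pos) (orthDilation K c⁻¹ y)
  rw [div_self (by exact_mod_cast Real.pi_ne_zero), Complex.one_cpow, one_mul] at h0
  rw [Real.fourier_eq] at h0 ⊢
  have h1 : ∀ ξ, Real.fourierChar (-⟪ξ, y⟫) • (plateGaussian K c ξ : ℂ) =
      (fun v => Real.fourierChar (-⟪v, orthDilation K c⁻¹ y⟫) •
        Complex.exp (-(Real.pi : ℂ) * (‖v‖ : ℂ) ^ 2)) (orthDilation K c ξ) := fun ξ => by
    simp only [inner_orthDilation_left, orthDilation_orthDilation_inv K hc, plateGaussian]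
    push_cast
    rfl
  rw [integral_congr_ae (.of_forall h1), integral_comp_orthDilation K hc
    (fun v => Real.fourierChar (-⟪v, orthDilation K c⁻¹ y⟫) •
      Complex.exp (-(Real.pi : ℂ) * (‖v‖ : ℂ) ^ 2)), h0, plateGaussian]
  push_cast
  congr 2
  have : (Real.pi : ℂ) ≠ 0 := by exact_mod_cast Real.pi_ne_zero
  field_simp

theorem integrable_plateGaussian (K : Submodule ℝ V) {c : ℝ} (hc : c ≠ 0) :
    Integrable (plateGaussian K c) := by
  refine ⟨(continuous_plateGaussian K c).aestronglyMeasurable, ?_⟩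
  have h := (integrable_gaussian (V := V) Real.pi_pos).2
  rw [HasFiniteIntegral] at h ⊢
  have h2 := lintegral_comp_orthDilation K hc (fun x => ‖Real.exp (-Real.pi * ‖x‖ ^ 2)‖ₑ)
  unfold plateGaussian
  rw [h2]
  exact ENNReal.mul_lt_top ENNReal.ofReal_lt_top h

/-- The constant in the comparison between averages over plates and Gaussian averages. -/
noncomputable def gaussianConst (V : Type*) [NormedAddCommGroup V] [InnerProductSpace ℝ V]
    [FiniteDimensional ℝ V] [MeasurableSpace V] [BorelSpace V] : ℝ≥0∞ :=
  ENNReal.ofReal (Real.exp (2 * Real.pi)) * (volume (Metric.ball (0 : V) 1))⁻¹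

theorem gaussianConst_lt_top : gaussianConst V < ∞ :=
  ENNReal.mul_lt_top ENNReal.ofReal_lt_top
    (ENNReal.inv_lt_top.2 (Metric.measure_ball_pos _ _ one_pos))

/-- The dilation maps the unit ball into the plate; this lower bound replaces the exact volume. -/
theorem volume_subspacePlate_ge (K : Submodule ℝ V) {c : ℝ} (hc : 0 < c) :
    ENNReal.ofReal |(LinearMap.det (orthDilation K c : V →ₗ[ℝ] V))| *
      volume (Metric.ball (0 : V) 1) ≤
      volume {ξ : V | ‖K.starProjection ξ‖ ≤ 1 ∧ ‖Kᗮ.starProjection ξ‖ < c} := by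
  rw [← Measure.addHaar_image_linearMap]
  refine measure_mono ?_
  rintro _ ⟨ξ, hξ, rfl⟩
  rw [mem_ball_zero_iff] at hξ
  simp only [ContinuousLinearMap.coe_coe]
  refine ⟨?_, ?_⟩
  · rw [starProjection_orthDilation]
    exact (Submodule.norm_starProjection_apply_le K ξ).trans hξ.le
  · rw [starProjection_orthogonal_orthDilation, norm_smul, Real.norm_of_nonneg hc.le]
    calc c * ‖Kᗮ.starProjection ξ‖ ≤ c * ‖ξ‖ := by
          gcongr
          exact Submodule.norm_starProjection_apply_le _ ξ
      _ < c * 1 := by gcongr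
      _ = c := mul_one c

/-- The multiplication formula transfers the integral to frequency, where the modulus of the
transform no longer depends on x. -/
theorem integral_plateGaussian_mul_le (K : Submodule ℝ V) {c : ℝ} (hc : 0 < c) {F : V → ℝ}
    (hF : Integrable F) (h0 : ∀ x, 0 ≤ F x) (x : V) :
    ∫⁻ y, ENNReal.ofReal (plateGaussian K c⁻¹ y * F (y + x)) ≤
      ENNReal.ofReal |(LinearMap.det (orthDilation K c : V →ₗ[ℝ] V))| *
      ∫⁻ ξ, ENNReal.ofReal (plateGaussian K c ξ) * ‖𝓕 (fun y => (F y : ℂ)) ξ‖ₑ := by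
  have hFx : Integrable fun y => F (y + x) := hF.comp_add_right x
  have hint : Integrable fun y => plateGaussian K c⁻¹ y * F (y + x) := by
    refine hFx.mono ((continuous_plateGaussian K _).aestronglyMeasurable.mul
      hFx.aestronglyMeasurable) (.of_forall fun y => ?_)
    rw [norm_mul]
    refine mul_le_of_le_one_left (norm_nonneg _) ?_
    rw [Real.norm_of_nonneg (plateGaussian_pos K _ y).le, plateGaussian]
    refine Real.exp_le_one_iff.2 ?_
    have := Real.pi_pos
    nlinarith [sq_nonneg ‖orthDilation K c⁻¹ y‖]
  have key := integral_fourier_mul_eq (integrable_plateGaussian K hc.ne').ofReal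
    (hFx.ofReal (𝕜 := ℂ))
  simp only [Complex.coe_algebraMap] at key
  simp_rw [fourier_plateGaussian K hc.ne'] at key
  set D := |(LinearMap.det (orthDilation K c : V →ₗ[ℝ] V))| with hD
  have hDpos : 0 < D := abs_pos.2 (det_orthDilation_ne_zero K hc.ne')
  have e1 : ∫ y, ((D⁻¹ * plateGaussian K c⁻¹ y : ℝ) : ℂ) * (F (y + x) : ℂ) =
      ((D⁻¹ * ∫ y, plateGaussian K c⁻¹ y * F (y + x) : ℝ) : ℂ) := by
    rw [← integral_const_mul, ← integral_complex_ofReal]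
    refine integral_congr_ae (.of_forall fun y => ?_)
    push_cast
    ring
  rw [e1] at key
  have hnn : 0 ≤ ∫ y, plateGaussian K c⁻¹ y * F (y + x) :=
    integral_nonneg fun y => mul_nonneg (plateGaussian_pos K _ y).le (h0 _)
  rw [← ofReal_integral_eq_lintegral_ofReal hint
    (.of_forall fun y => mul_nonneg (plateGaussian_pos K _ y).le (h0 _))]
  calc ENNReal.ofReal (∫ y, plateGaussian K c⁻¹ y * F (y + x))
      = ENNReal.ofReal D * ENNReal.ofReal (D⁻¹ * ∫ y, plateGaussian K c⁻¹ y * F (y + x)) := by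
        rw [← ENNReal.ofReal_mul hDpos.le, mul_inv_cancel_left₀ hDpos.ne']
    _ = ENNReal.ofReal D *
        ‖((D⁻¹ * ∫ y, plateGaussian K c⁻¹ y * F (y + x) : ℝ) : ℂ)‖ₑ := by
        rw [← ofReal_norm, Complex.norm_real, Real.norm_of_nonneg (by positivity)]
    _ ≤ _ := by
        rw [key]
        gcongr
        refine (enorm_integral_le_lintegral_enorm _).trans (le_of_eq ?_)
        refine lintegral_congr fun ξ => ?_
        rw [enorm_mul, ← ofReal_norm, Complex.norm_real,
          Real.norm_of_nonneg (plateGaussian_pos K _ ξ).le, ← ofReal_norm, ← ofReal_norm,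
          norm_fourier_comp_add_right (fun y => (F y : ℂ)) x ξ]

theorem laverage_plate_le (K : Submodule ℝ V) {c : ℝ} (hc : 0 < c) {F : V → ℝ}
    (hF : Integrable F) (h0 : ∀ x, 0 ≤ F x) (x : V) :
    ⨍⁻ y in x +ᵥ {ξ : V | ‖K.starProjection ξ‖ ≤ 1 ∧ ‖Kᗮ.starProjection ξ‖ < c},
      ENNReal.ofReal (F y) ∂volume ≤
      gaussianConst V *
        ∫⁻ ξ, ENNReal.ofReal (plateGaussian K c ξ) * ‖𝓕 (fun y => (F y : ℂ)) ξ‖ₑ := by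
  set T := {ξ : V | ‖K.starProjection ξ‖ ≤ 1 ∧ ‖Kᗮ.starProjection ξ‖ < c} with hT
  set J := ∫⁻ ξ, ENNReal.ofReal (plateGaussian K c ξ) * ‖𝓕 (fun y => (F y : ℂ)) ξ‖ₑ with hJ
  set D := |(LinearMap.det (orthDilation K c : V →ₗ[ℝ] V))| with hD
  have hDpos : 0 < D := abs_pos.2 (det_orthDilation_ne_zero K hc.ne')
  have hTm : MeasurableSet T := by
    have h1 : MeasurableSet {ξ : V | ‖K.starProjection ξ‖ ≤ 1} :=
      (isClosed_le (by fun_prop) continuous_const).measurableSet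
    have h2 : MeasurableSet {ξ : V | ‖Kᗮ.starProjection ξ‖ < c} :=
      (isOpen_lt (by fun_prop) continuous_const).measurableSet
    exact h1.inter h2
  have e1 : ∫⁻ y in x +ᵥ T, ENNReal.ofReal (F y) = ∫⁻ y in T, ENNReal.ofReal (F (y + x)) := by
    rw [← lintegral_indicator (hTm.const_vadd x), ← lintegral_indicator hTm,
      ← lintegral_add_right_eq_self _ x]
    refine lintegral_congr fun y => ?_
    have : y + x ∈ x +ᵥ T ↔ y ∈ T := by
      rw [mem_vadd_set_iff_neg_vadd_mem, vadd_eq_add, add_comm y x, neg_add_cancel_left]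
    by_cases hy : y ∈ T
    · rw [indicator_of_mem hy, indicator_of_mem (this.2 hy)]
    · rw [indicator_of_notMem hy, indicator_of_notMem (fun h => hy (this.1 h))]
  have e2 : ∫⁻ y in T, ENNReal.ofReal (F (y + x)) ≤
      ENNReal.ofReal (Real.exp (2 * Real.pi)) * (ENNReal.ofReal D * J) := by
    calc ∫⁻ y in T, ENNReal.ofReal (F (y + x))
        ≤ ∫⁻ y in T, ENNReal.ofReal (Real.exp (2 * Real.pi)) *
            ENNReal.ofReal (plateGaussian K c⁻¹ y * F (y + x)) := by
          refine setLIntegral_mono' hTm fun y hy => ?_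
          rw [← ENNReal.ofReal_mul (Real.exp_pos _).le]
          refine ENNReal.ofReal_le_ofReal ?_
          rw [← mul_assoc]
          exact le_mul_of_one_le_left (h0 _) (one_le_plateGaussian K hc hy.1 hy.2)
      _ ≤ ∫⁻ y, ENNReal.ofReal (Real.exp (2 * Real.pi)) *
            ENNReal.ofReal (plateGaussian K c⁻¹ y * F (y + x)) := setLIntegral_le_lintegral _ _
      _ = ENNReal.ofReal (Real.exp (2 * Real.pi)) *
            ∫⁻ y, ENNReal.ofReal (plateGaussian K c⁻¹ y * F (y + x)) :=
          lintegral_const_mul' _ _ ENNReal.ofReal_ne_top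
      _ ≤ _ := by
          gcongr
          exact integral_plateGaussian_mul_le K hc hF h0 x
  rw [setLAverage_eq, measure_vadd, e1, ENNReal.div_eq_inv_mul]
  have hb0 : volume (Metric.ball (0 : V) 1) ≠ 0 := (Metric.measure_ball_pos _ _ one_pos).ne'
  have hD0 : ENNReal.ofReal D ≠ 0 := (ENNReal.ofReal_pos.2 hDpos).ne'
  calc (volume T)⁻¹ * ∫⁻ y in T, ENNReal.ofReal (F (y + x))
      ≤ (ENNReal.ofReal D * volume (Metric.ball (0 : V) 1))⁻¹ *
        (ENNReal.ofReal (Real.exp (2 * Real.pi)) * (ENNReal.ofReal D * J)) := by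
        gcongr
        exact volume_subspacePlate_ge K hc
    -- The determinant from the volume cancels the one from the Fourier transform, so the constant
    -- depends neither on K nor on c.
    _ = ((ENNReal.ofReal D)⁻¹ * ENNReal.ofReal D) * (gaussianConst V * J) := by
        rw [ENNReal.mul_inv (.inl hD0) (.inl ENNReal.ofReal_ne_top), gaussianConst]
        ring
    _ = gaussianConst V * J := by
        rw [ENNReal.inv_mul_cancel hD0 ENNReal.ofReal_ne_top, one_mul]

end Dilation

end KakeyaGr

namespace KakeyaGr

/-! ### Decay of the Gaussian mean over the Grassmannian -/

section Average

variable {d n : ℕ}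

theorem continuous_proj : Continuous (Gr.proj : Gr d n → E n →L[ℝ] E n) :=
  continuous_induced_dom

theorem Gr.projPerp_eq (σ : Gr d n) : σ.projPerp = 1 - σ.proj :=
  Submodule.starProjection_orthogonal' σ.1

theorem continuous_projPerp : Continuous (Gr.projPerp : Gr d n → E n →L[ℝ] E n) := by
  rw [show (Gr.projPerp : Gr d n → E n →L[ℝ] E n) = fun σ => 1 - σ.proj from
    funext Gr.projPerp_eq]
  exact continuous_const.sub continuous_proj

theorem norm_rot_proj (h : d ≤ n) (ω : O n) (x : E n) :
    ‖(rot h ω).proj x‖ =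
      ‖(stdSubspace h).starProjection ((Unitary.linearIsometryEquiv ω).symm x)‖ := by
  have : (rot h ω).proj x = Unitary.linearIsometryEquiv ω
      ((stdSubspace h).starProjection ((Unitary.linearIsometryEquiv ω).symm x)) :=
    Submodule.starProjection_map_apply (Unitary.linearIsometryEquiv ω) (stdSubspace h) x
  rw [this, LinearIsometryEquiv.norm_map]

theorem orthDilation_single_of_lt (h : d ≤ n) (c : ℝ) {i : Fin n} (hi : (i : ℕ) < d) :
    orthDilation (stdSubspace h) c (EuclideanSpace.single i 1) = EuclideanSpace.single i 1 := by
  have hm : EuclideanSpace.single i (1 : ℝ) ∈ stdSubspace h :=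
    Submodule.subset_span ⟨⟨i, hi⟩, rfl⟩
  have h1 : (stdSubspace h).starProjection (EuclideanSpace.single i 1) =
      EuclideanSpace.single i 1 := Submodule.starProjection_eq_self_iff.2 hm
  have h2 : (stdSubspace h)ᗮ.starProjection (EuclideanSpace.single i 1) = 0 :=
    (Submodule.starProjection_apply_eq_zero_iff (K := (stdSubspace h)ᗮ)).2
      (Submodule.le_orthogonal_orthogonal _ hm)
  rw [orthDilation_apply, h1, h2, smul_zero, add_zero]

theorem orthDilation_single_of_not_lt (h : d ≤ n) (c : ℝ) {i : Fin n} (hi : ¬ (i : ℕ) < d) :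
    orthDilation (stdSubspace h) c (EuclideanSpace.single i 1) =
      c • EuclideanSpace.single i 1 := by
  have hm : EuclideanSpace.single i (1 : ℝ) ∈ (stdSubspace h)ᗮ := by
    refine (Submodule.mem_orthogonal _ _).2 fun u hu => ?_
    induction hu using Submodule.span_induction with
    | mem x hx =>
      obtain ⟨j, rfl⟩ := hx
      have hne : Fin.castLE h j ≠ i := by
        rintro rfl
        exact hi j.2
      simp [EuclideanSpace.inner_single_left, hne]
    | zero => simp
    | add x y _ _ hx hy => rw [inner_add_left, hx, hy, add_zero]
    | smul a x _ hx => rw [inner_smul_left, hx, mul_zero]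
  have h1 : (stdSubspace h)ᗮ.starProjection (EuclideanSpace.single i 1) =
      EuclideanSpace.single i 1 := Submodule.starProjection_eq_self_iff.2 hm
  have h2 : (stdSubspace h).starProjection (EuclideanSpace.single i 1) = 0 :=
    (Submodule.starProjection_apply_eq_zero_iff (K := stdSubspace h)).2 hm
  rw [orthDilation_apply, h1, h2, zero_add]

theorem det_orthDilation_stdSubspace (h : d ≤ n) (c : ℝ) :
    LinearMap.det (orthDilation (stdSubspace h) c : E n →ₗ[ℝ] E n) = c ^ (n - d) := by
  let b := (EuclideanSpace.basisFun (Fin n) ℝ).toBasis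
  have hm : LinearMap.toMatrix b b (orthDilation (stdSubspace h) c : E n →ₗ[ℝ] E n) =
      Matrix.diagonal fun i : Fin n => if (i : ℕ) < d then 1 else c := by
    ext i j
    rw [LinearMap.toMatrix_apply]
    have hb : b j = EuclideanSpace.single j 1 := by simp [b]
    rw [hb, ContinuousLinearMap.coe_coe]
    by_cases hj : (j : ℕ) < d
    · rw [orthDilation_single_of_lt h c hj]
      by_cases hij : i = j
      · subst hij; simp [b, hj]
      · simp [b, hij]
    · rw [orthDilation_single_of_not_lt h c hj]
      by_cases hij : i = j
      · subst hij; simp [b, hj]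
      · simp [b, hij]
  rw [← LinearMap.det_toMatrix b, hm, Matrix.det_diagonal, Finset.prod_ite, Finset.prod_const_one,
    one_mul, Finset.prod_const]
  congr 1
  have h1 := Finset.card_filter_add_card_filter_not (s := (Finset.univ : Finset (Fin n)))
    (fun i => (i : ℕ) < d)
  have h2 : (Finset.univ.filter fun i : Fin n => (i : ℕ) < d).card = d := by
    rw [Fin.card_filter_val_lt, min_eq_right h]
  rw [h2, Finset.card_univ, Fintype.card_fin] at h1
  omega

theorem exists_unitary_apply_eq {ξ η : E n} (h : ‖ξ‖ = ‖η‖) :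
    ∃ ρ : O n, Unitary.linearIsometryEquiv ρ ξ = η := by
  refine ⟨Unitary.linearIsometryEquiv.symm ((ℝ ∙ (ξ - η))ᗮ.reflection), ?_⟩
  rw [MulEquiv.apply_symm_apply]
  exact Submodule.reflection_sub h

/-- The average over the Grassmannian of a Gaussian in the directions of the subspace. -/
noncomputable def meanGaussian (h : d ≤ n) (ξ : E n) : ℝ≥0∞ :=
  ∫⁻ ω, ENNReal.ofReal (Real.exp (-(Real.pi / 2) * ‖(rot h ω).proj ξ‖ ^ 2)) ∂haarO n

theorem continuous_rot_proj (h : d ≤ n) :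
    Continuous fun p : O n × E n => (rot h p.1).proj p.2 :=
  (continuous_proj.comp ((continuous_rot h).comp continuous_fst)).clm_apply continuous_snd

instance instIsMulLeftInvariantHaarO (n : ℕ) : (haarO n).IsMulLeftInvariant := by
  unfold haarO
  infer_instance

/-- O(n) is transitive on spheres, by reflections, and Haar measure is left invariant. -/
theorem meanGaussian_eq_of_norm_eq (h : d ≤ n) {ξ η : E n} (hn : ‖ξ‖ = ‖η‖) :
    meanGaussian h ξ = meanGaussian h η := by
  obtain ⟨ρ, rfl⟩ := exists_unitary_apply_eq hn
  unfold meanGaussian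
  conv_rhs => rw [← lintegral_mul_left_eq_self _ ρ]
  refine lintegral_congr fun ω => ?_
  have : (Unitary.linearIsometryEquiv (ρ * ω)).symm (Unitary.linearIsometryEquiv ρ ξ) =
      (Unitary.linearIsometryEquiv ω).symm ξ := by
    rw [map_mul]
    rw [LinearIsometryEquiv.symm_apply_eq, LinearIsometryEquiv.coe_mul, Function.comp_apply,
      LinearIsometryEquiv.apply_symm_apply]
  rw [norm_rot_proj, norm_rot_proj, this]

/-- By radiality η may be replaced by tξ with 0 ≤ t ≤ 1, and shrinking ξ along its ray shrinks every
projection. -/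
theorem meanGaussian_anti (h : d ≤ n) {ξ η : E n} (hn : ‖η‖ ≤ ‖ξ‖) :
    meanGaussian h ξ ≤ meanGaussian h η := by
  rcases eq_or_ne ξ 0 with rfl | hξ
  · have : η = 0 := by simpa using hn
    rw [this]
  have hξ' : 0 < ‖ξ‖ := norm_pos_iff.2 hξ
  set t := ‖η‖ / ‖ξ‖ with ht
  have ht0 : 0 ≤ t := by positivity
  have ht1 : t ≤ 1 := (div_le_one hξ').2 hn
  have e : ‖t • ξ‖ = ‖η‖ := by
    rw [norm_smul, Real.norm_of_nonneg ht0, ht, div_mul_cancel₀ _ hξ'.ne']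
  rw [← meanGaussian_eq_of_norm_eq h e]
  refine lintegral_mono fun ω => ENNReal.ofReal_le_ofReal (Real.exp_le_exp.2 ?_)
  rw [map_smul, norm_smul, Real.norm_of_nonneg ht0]
  have h1 : t * ‖(rot h ω).proj ξ‖ ≤ ‖(rot h ω).proj ξ‖ :=
    mul_le_of_le_one_left (norm_nonneg _) ht1
  have h2 : (t * ‖(rot h ω).proj ξ‖) ^ 2 ≤ ‖(rot h ω).proj ξ‖ ^ 2 := by gcongr
  nlinarith [Real.pi_pos]

/-- Swap the integrals: a rotation preserves the ball, so every ω contributes the same amount. -/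
theorem setLIntegral_meanGaussian (h : d ≤ n) (R : ℝ) :
    ∫⁻ ξ in Metric.ball (0 : E n) R, meanGaussian h ξ =
      ∫⁻ ξ in Metric.ball (0 : E n) R,
        ENNReal.ofReal (Real.exp (-(Real.pi / 2) * ‖(stdSubspace h).starProjection ξ‖ ^ 2)) := by
  unfold meanGaussian
  rw [lintegral_lintegral_swap]
  · have key : ∀ ω : O n, ∫⁻ ξ in Metric.ball (0 : E n) R,
        ENNReal.ofReal (Real.exp (-(Real.pi / 2) * ‖(rot h ω).proj ξ‖ ^ 2)) =
        ∫⁻ ξ in Metric.ball (0 : E n) R,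
        ENNReal.ofReal
          (Real.exp (-(Real.pi / 2) * ‖(stdSubspace h).starProjection ξ‖ ^ 2)) := by
      intro ω
      have hmp := (Unitary.linearIsometryEquiv ω).symm.measurePreserving
      have hpre : (Unitary.linearIsometryEquiv ω).symm ⁻¹' Metric.ball (0 : E n) R =
          Metric.ball 0 R := by
        ext x; simp
      conv_rhs => rw [← hmp.setLIntegral_comp_preimage Metric.isOpen_ball.measurableSet
        (by fun_prop), hpre]
      simp_rw [norm_rot_proj]
    simp_rw [key]
    simp
  · refine Measurable.aemeasurable ?_
    have hc := (continuous_rot_proj h).comp (continuous_swap (X := E n) (Y := O n))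
    have hc' : Continuous fun p : E n × O n => (rot h p.2).proj p.1 := hc
    refine ENNReal.measurable_ofReal.comp ?_
    refine Continuous.measurable ?_
    exact Real.continuous_exp.comp (continuous_const.mul (hc'.norm.pow 2))

/-- In the ball the component orthogonal to the subspace has length at most R, so inserting a
Gaussian of width R in those n - d directions costs only exp(π/2). The change of variables then
produces R^(n-d). -/
theorem setLIntegral_exp_stdSubspace_le (h : d ≤ n) {R : ℝ} (hR : 0 < R) :
    ∫⁻ ξ in Metric.ball (0 : E n) R,
        ENNReal.ofReal (Real.exp (-(Real.pi / 2) * ‖(stdSubspace h).starProjection ξ‖ ^ 2)) ≤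
      ENNReal.ofReal (Real.exp (Real.pi / 2) * R ^ (n - d) *
        ∫ x : E n, Real.exp (-(Real.pi / 2) * ‖x‖ ^ 2)) := by
  set K := stdSubspace h
  have hb : 0 < Real.pi / 2 := by positivity
  calc ∫⁻ ξ in Metric.ball (0 : E n) R,
        ENNReal.ofReal (Real.exp (-(Real.pi / 2) * ‖K.starProjection ξ‖ ^ 2))
      ≤ ∫⁻ ξ in Metric.ball (0 : E n) R, ENNReal.ofReal (Real.exp (Real.pi / 2)) *
          ENNReal.ofReal (Real.exp (-(Real.pi / 2) * ‖orthDilation K R⁻¹ ξ‖ ^ 2)) := by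
        refine setLIntegral_mono' Metric.isOpen_ball.measurableSet fun ξ hξ => ?_
        rw [← ENNReal.ofReal_mul (Real.exp_pos _).le, ← Real.exp_add]
        refine ENNReal.ofReal_le_ofReal (Real.exp_le_exp.2 ?_)
        rw [norm_sq_orthDilation, ← mul_pow]
        rw [mem_ball_zero_iff] at hξ
        have h1 : R⁻¹ * ‖Kᗮ.starProjection ξ‖ ≤ 1 := by
          rw [inv_mul_le_iff₀ hR, mul_one]
          exact (Submodule.norm_starProjection_apply_le _ ξ).trans hξ.le
        have h2 : (R⁻¹ * ‖Kᗮ.starProjection ξ‖) ^ 2 ≤ 1 := pow_le_one₀ (by positivity) h1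
        nlinarith
    _ ≤ ∫⁻ ξ, ENNReal.ofReal (Real.exp (Real.pi / 2)) *
          ENNReal.ofReal (Real.exp (-(Real.pi / 2) * ‖orthDilation K R⁻¹ ξ‖ ^ 2)) :=
        setLIntegral_le_lintegral _ _
    _ = ENNReal.ofReal (Real.exp (Real.pi / 2)) * (ENNReal.ofReal (R ^ (n - d)) *
          ∫⁻ x : E n, ENNReal.ofReal (Real.exp (-(Real.pi / 2) * ‖x‖ ^ 2))) := by
        rw [lintegral_const_mul' _ _ ENNReal.ofReal_ne_top,
          lintegral_comp_orthDilation K (inv_ne_zero hR.ne')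
            (fun x => ENNReal.ofReal (Real.exp (-(Real.pi / 2) * ‖x‖ ^ 2))),
          det_orthDilation_stdSubspace]
        congr 3
        rw [abs_of_nonneg (by positivity), inv_pow, inv_inv]
    _ = _ := by
        rw [← ofReal_integral_eq_lintegral_ofReal (integrable_gaussian hb)
          (.of_forall fun x => (Real.exp_pos _).le), ← ENNReal.ofReal_mul (by positivity),
          ← ENNReal.ofReal_mul (Real.exp_pos _).le, mul_assoc]

theorem meanGaussian_le_one (h : d ≤ n) (ξ : E n) : meanGaussian h ξ ≤ 1 := by
  calc meanGaussian h ξ ≤ ∫⁻ _ω, 1 ∂haarO n := by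
        refine lintegral_mono fun ω => ?_
        rw [← ENNReal.ofReal_one]
        refine ENNReal.ofReal_le_ofReal (Real.exp_le_one_iff.2 ?_)
        have := Real.pi_pos
        nlinarith [sq_nonneg ‖(rot h ω).proj ξ‖]
    _ = 1 := by simp

/-- A radially nonincreasing function is at most its mean over the ball of radius |ξ|. The integral
there is O(|ξ|^(n-d)) and the volume is comparable to |ξ|^n, which leaves |ξ|^(-d). -/
theorem exists_meanGaussian_le (h : d ≤ n) :
    ∃ C : ℝ, 0 < C ∧ ∀ ξ : E n, meanGaussian h ξ ≤ ENNReal.ofReal (C * ((1 + ‖ξ‖) ^ d)⁻¹) := by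
  set I := ∫ x : E n, Real.exp (-(Real.pi / 2) * ‖x‖ ^ 2) with hI
  set v := (volume (Metric.ball (0 : E n) 1)).toReal with hv
  have hv0 : 0 < v := ENNReal.toReal_pos (Metric.measure_ball_pos _ _ one_pos).ne'
    measure_ball_lt_top.ne
  have hI0 : 0 ≤ I := integral_nonneg fun x => (Real.exp_pos _).le
  set A := Real.exp (Real.pi / 2) * I / v with hA
  have hA0 : 0 ≤ A := by positivity
  have hfar : ∀ ξ : E n, 0 < ‖ξ‖ → meanGaussian h ξ ≤ ENNReal.ofReal (A * (‖ξ‖ ^ d)⁻¹) := by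
    intro ξ hξ
    have h1 : meanGaussian h ξ * volume (Metric.ball (0 : E n) ‖ξ‖) ≤
        ENNReal.ofReal (Real.exp (Real.pi / 2) * ‖ξ‖ ^ (n - d) * I) := by
      rw [← setLIntegral_const]
      refine le_trans ?_ (setLIntegral_exp_stdSubspace_le h hξ)
      rw [← setLIntegral_meanGaussian]
      refine setLIntegral_mono' Metric.isOpen_ball.measurableSet fun η hη => ?_
      exact meanGaussian_anti h (mem_ball_zero_iff.1 hη).le
    have h2 : volume (Metric.ball (0 : E n) ‖ξ‖) = ENNReal.ofReal (‖ξ‖ ^ n * v) := by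
      rw [Measure.addHaar_ball_of_pos _ _ hξ, finrank_euclideanSpace_fin,
        ENNReal.ofReal_mul (by positivity), hv, ENNReal.ofReal_toReal measure_ball_lt_top.ne]
    rw [h2] at h1
    have h3 : 0 < ‖ξ‖ ^ n * v := by positivity
    rw [← ENNReal.le_div_iff_mul_le (.inl (ENNReal.ofReal_pos.2 h3).ne')
      (.inl ENNReal.ofReal_ne_top), ← ENNReal.ofReal_div_of_pos h3] at h1
    refine h1.trans (ENNReal.ofReal_le_ofReal (le_of_eq ?_))
    have h4 : ‖ξ‖ ^ n = ‖ξ‖ ^ (n - d) * ‖ξ‖ ^ d := by rw [← pow_add, Nat.sub_add_cancel h]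
    rw [h4, hA]
    field_simp
  -- The factor 2^d compares 1 + |ξ| with max(1, |ξ|); A serves |ξ| ≥ 1 and the added 1 serves the
  -- trivial bound for |ξ| < 1.
  refine ⟨2 ^ d * (A + 1), by positivity, fun ξ => ?_⟩
  rcases le_or_gt 1 ‖ξ‖ with h1 | h1
  · refine (hfar ξ (by linarith)).trans (ENNReal.ofReal_le_ofReal ?_)
    have hle : (1 + ‖ξ‖) ^ d ≤ 2 ^ d * ‖ξ‖ ^ d := by
      rw [← mul_pow]
      gcongr
      linarith
    have hp : 0 < ‖ξ‖ ^ d := by positivity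
    rw [← div_eq_mul_inv, ← div_eq_mul_inv, div_le_div_iff₀ hp (by positivity)]
    nlinarith [mul_le_mul_of_nonneg_left hle hA0, mul_pos (pow_pos (zero_lt_two (α := ℝ)) d) hp]
  · refine (meanGaussian_le_one h ξ).trans ?_
    rw [← ENNReal.ofReal_one]
    refine ENNReal.ofReal_le_ofReal ?_
    have hle : (1 + ‖ξ‖) ^ d ≤ 2 ^ d := by
      gcongr
      linarith
    rw [← div_eq_mul_inv, le_div_iff₀ (by positivity), one_mul]
    nlinarith [mul_nonneg (pow_pos (zero_lt_two (α := ℝ)) d).le hA0]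

end Average

end KakeyaGr

namespace KakeyaGr

/-! ### The integral of the squared weight in the three regimes -/

section Weight

/-- The square of the weight dominating the mean of the Gaussians adapted to the dual plates. -/
noncomputable def sqWeight (d : ℕ) (δ y : ℝ) : ℝ :=
  ((1 + y) ^ (2 * d))⁻¹ * Real.exp (-(Real.pi * δ ^ 2) * y ^ 2)

theorem sqWeight_nonneg (d : ℕ) (δ : ℝ) {y : ℝ} (hy : 0 ≤ y) : 0 ≤ sqWeight d δ y := by
  unfold sqWeight
  positivity

theorem measurable_sqWeight (d : ℕ) (δ : ℝ) : Measurable (sqWeight d δ) := by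
  unfold sqWeight
  fun_prop

variable {d n : ℕ}

/-- Polar coordinates: it is enough to majorize the radial density by an integrable D. -/
theorem lintegral_sqWeight_le (hn : 0 < n) {δ B : ℝ} {D : ℝ → ℝ} (hDi : IntegrableOn D (Ioi 0))
    (hD : ∀ y, 0 < y → y ^ (n - 1) * sqWeight d δ y ≤ D y) (hB : ∫ y in Ioi 0, D y ≤ B) :
    ∫⁻ ξ : E n, ENNReal.ofReal (sqWeight d δ ‖ξ‖) ≤
      ENNReal.ofReal (n * (volume.real (Metric.ball (0 : E n) 1) * B)) := by
  have : Nonempty (Fin n) := ⟨⟨0, hn⟩⟩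
  have hmeas : Measurable fun y => y ^ (n - 1) * sqWeight d δ y :=
    (measurable_id.pow_const _).mul (measurable_sqWeight d δ)
  have hi : IntegrableOn (fun y => y ^ (n - 1) * sqWeight d δ y) (Ioi 0) := by
    refine Integrable.mono' hDi hmeas.aestronglyMeasurable ?_
    refine (ae_restrict_iff' measurableSet_Ioi).2 (.of_forall fun y hy => ?_)
    have hy' : (0 : ℝ) < y := hy
    rw [Real.norm_of_nonneg (mul_nonneg (by positivity) (sqWeight_nonneg d δ hy'.le))]
    exact hD y hy'
  have hint : Integrable (fun ξ : E n => sqWeight d δ ‖ξ‖) := by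
    refine (integrable_fun_norm_addHaar (E := E n) volume).2 ?_
    simpa using hi
  rw [← ofReal_integral_eq_lintegral_ofReal hint
    (.of_forall fun x => sqWeight_nonneg d δ (norm_nonneg _))]
  refine ENNReal.ofReal_le_ofReal ?_
  rw [integral_fun_norm_addHaar, finrank_euclideanSpace_fin, nsmul_eq_mul, smul_eq_mul]
  gcongr
  refine le_trans ?_ hB
  refine setIntegral_mono_on (by simpa using hi) hDi measurableSet_Ioi fun y hy => ?_
  simpa using hD y hy

theorem exists_lintegral_sqWeight_le_of_lt (h : n < 2 * d) :
    ∃ C : ℝ, 0 < C ∧ ∀ δ : ℝ,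
      ∫⁻ ξ : E n, ENNReal.ofReal (sqWeight d δ ‖ξ‖) ≤ ENNReal.ofReal C := by
  have hi : Integrable fun x : E n => (1 + ‖x‖) ^ (-((2 * d : ℕ) : ℝ)) :=
    integrable_one_add_norm (by rw [finrank_euclideanSpace_fin]; exact_mod_cast h)
  have h0 : 0 ≤ ∫ x : E n, (1 + ‖x‖) ^ (-((2 * d : ℕ) : ℝ)) :=
    integral_nonneg fun x => by positivity
  refine ⟨(∫ x : E n, (1 + ‖x‖) ^ (-((2 * d : ℕ) : ℝ))) + 1, by positivity, fun δ => ?_⟩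
  refine le_trans ?_ (ENNReal.ofReal_le_ofReal (le_add_of_nonneg_right zero_le_one))
  rw [ofReal_integral_eq_lintegral_ofReal hi (.of_forall fun x => by positivity)]
  refine lintegral_mono fun x => ENNReal.ofReal_le_ofReal ?_
  rw [Real.rpow_neg (by positivity), Real.rpow_natCast, sqWeight]
  refine mul_le_of_le_one_right (by positivity) (Real.exp_le_one_iff.2 ?_)
  have := Real.pi_pos
  have : 0 ≤ Real.pi * δ ^ 2 * ‖x‖ ^ 2 := by positivity
  linarith

theorem exists_lintegral_sqWeight_le_of_gt (h : 2 * d < n) :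
    ∃ C : ℝ, 0 < C ∧ ∀ δ : ℝ, 0 < δ →
      ∫⁻ ξ : E n, ENNReal.ofReal (sqWeight d δ ‖ξ‖) ≤
        ENNReal.ofReal (C * (δ ^ ((d : ℝ) - (n : ℝ) / 2)) ^ 2) := by
  have hn : 0 < n := by omega
  -- The natural subtraction is exact because 2d < n. Bounding 1 + y below by y leaves y^q times a
  -- Gaussian, a Gamma integral of size δ^(-(q+1)) = δ^(2d-n).
  set q : ℝ := ((n - 1 - 2 * d : ℕ) : ℝ) with hq
  have hq1 : -1 < q := lt_of_lt_of_le (by norm_num) (Nat.cast_nonneg _)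
  have hqn : q = (n : ℝ) - 1 - 2 * d := by
    rw [hq, Nat.cast_sub (by omega), Nat.cast_sub (by omega)]
    push_cast
    ring
  set c : ℝ := Real.pi ^ (-(q + 1) / 2) * (1 / 2) * Real.Gamma ((q + 1) / 2) with hc
  have hc0 : 0 < c := by
    have : 0 < Real.Gamma ((q + 1) / 2) := Real.Gamma_pos_of_pos (by linarith)
    positivity
  set v := volume.real (Metric.ball (0 : E n) 1) with hv
  have hv0 : 0 < v := ENNReal.toReal_pos (Metric.measure_ball_pos _ _ one_pos).ne'
    measure_ball_lt_top.ne
  have hn' : (0 : ℝ) < n := by exact_mod_cast hn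
  refine ⟨n * (v * c), by positivity, fun δ hδ => ?_⟩
  have hb : 0 < Real.pi * δ ^ 2 := by positivity
  refine (lintegral_sqWeight_le (D := fun y => y ^ q * Real.exp (-(Real.pi * δ ^ 2) * y ^ 2))
    (B := c * (δ ^ ((d : ℝ) - (n : ℝ) / 2)) ^ 2) hn
    (integrableOn_rpow_mul_exp_neg_mul_sq hb hq1) (fun y hy => ?_) ?_).trans ?_
  · rw [sqWeight, ← mul_assoc]
    refine mul_le_mul_of_nonneg_right ?_ (Real.exp_pos _).le
    rw [hq, Real.rpow_natCast, ← div_eq_mul_inv, div_le_iff₀ (by positivity)]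
    calc y ^ (n - 1) = y ^ (n - 1 - 2 * d) * y ^ (2 * d) := by
          rw [← pow_add]; congr 1; omega
      _ ≤ _ := by gcongr; linarith
  · have e := integral_rpow_mul_exp_neg_mul_rpow (p := 2) (q := q) (b := Real.pi * δ ^ 2)
      (by norm_num) hq1 hb
    simp only [Real.rpow_two] at e
    rw [e, hc]
    rw [Real.mul_rpow Real.pi_pos.le (by positivity)]
    have e2 : (δ ^ 2) ^ (-(q + 1) / 2) = (δ ^ ((d : ℝ) - (n : ℝ) / 2)) ^ 2 := by
      rw [← Real.rpow_natCast, ← Real.rpow_natCast, ← Real.rpow_mul hδ.le, ← Real.rpow_mul hδ.le,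
        hqn]
      congr 1
      push_cast
      ring
    rw [e2]
    apply le_of_eq
    ring
  · apply le_of_eq
    congr 1
    ring

/-- The radial density is at most (1+y)⁻¹ times a Gaussian. Up to 1/δ the Gaussian is dropped,
leaving a logarithm; beyond 1/δ one has (1+y)⁻¹ ≤ δ, and the Gaussian integral contributes 1/2. -/
theorem exists_lintegral_sqWeight_le_of_eq (hd : 1 ≤ d) (h : 2 * d = n) :
    ∃ C : ℝ, 0 < C ∧ ∀ δ : ℝ, 0 < δ → δ ≤ 1 / 2 →
      ∫⁻ ξ : E n, ENNReal.ofReal (sqWeight d δ ‖ξ‖) ≤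
        ENNReal.ofReal (C * Real.log (1 / δ) ^ 2) := by
  have hn : 0 < n := by omega
  have hn' : (0 : ℝ) < n := by exact_mod_cast hn
  set v := volume.real (Metric.ball (0 : E n) 1) with hv
  have hv0 : 0 < v := ENNReal.toReal_pos (Metric.measure_ball_pos _ _ one_pos).ne'
    measure_ball_lt_top.ne
  have hl2 : 1 / 2 < Real.log 2 := by linarith [Real.log_two_gt_d9]
  -- With L = log(1/δ) > 1/2 the one-dimensional integral is at most 2L + 1/2, and 2L ≤ 4L², 1/2 ≤
  -- 2L², whence 6L². The square is a deliberate loss, to match the stated bound.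
  refine ⟨n * (v * 6), by positivity, fun δ hδ hδ2 => ?_⟩
  have hb : 0 < Real.pi * δ ^ 2 := by positivity
  have hinv : 2 ≤ 1 / δ := by rw [le_div_iff₀ hδ]; linarith
  have hlog : 1 / 2 < Real.log (1 / δ) :=
    hl2.trans_le (Real.log_le_log (by norm_num) hinv)
  have hpos : 0 < 1 / δ := by positivity
  have hi1 : IntegrableOn (fun y : ℝ => (1 + y)⁻¹) (Ioc 0 (1 / δ)) := by
    refine (ContinuousOn.integrableOn_Icc ?_).mono_set Ioc_subset_Icc_self
    refine ContinuousOn.inv₀ (by fun_prop) fun y hy => ?_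
    have := hy.1
    positivity
  have hi1' : Integrable ((Ioc 0 (1 / δ)).indicator fun y : ℝ => (1 + y)⁻¹) :=
    (integrable_indicator_iff measurableSet_Ioc).2 hi1
  have hi2 : Integrable fun y : ℝ => δ * Real.exp (-(Real.pi * δ ^ 2) * y ^ 2) :=
    (integrable_exp_neg_mul_sq hb).const_mul δ
  refine (lintegral_sqWeight_le (D := fun y => (Ioc 0 (1 / δ)).indicator (fun y => (1 + y)⁻¹) y +
      δ * Real.exp (-(Real.pi * δ ^ 2) * y ^ 2))
    (B := 6 * Real.log (1 / δ) ^ 2) hn (hi1'.add hi2).integrableOn (fun y hy => ?_) ?_).trans ?_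
  · have h1 : y ^ (n - 1) * sqWeight d δ y ≤
        (1 + y)⁻¹ * Real.exp (-(Real.pi * δ ^ 2) * y ^ 2) := by
      rw [sqWeight, ← mul_assoc]
      refine mul_le_mul_of_nonneg_right ?_ (Real.exp_pos _).le
      rw [h, ← div_eq_mul_inv, div_le_iff₀ (by positivity)]
      calc y ^ (n - 1) ≤ (1 + y) ^ (n - 1) := by gcongr; linarith
        _ = (1 + y)⁻¹ * (1 + y) ^ n := by
          obtain ⟨m, rfl⟩ : ∃ m, n = m + 1 := ⟨n - 1, by omega⟩
          rw [Nat.add_sub_cancel, pow_succ]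
          field_simp
    refine h1.trans ?_
    by_cases hy1 : y ≤ 1 / δ
    · rw [indicator_of_mem (show y ∈ Ioc 0 (1 / δ) from ⟨hy, hy1⟩)]
      have : (1 + y)⁻¹ * Real.exp (-(Real.pi * δ ^ 2) * y ^ 2) ≤ (1 + y)⁻¹ := by
        refine mul_le_of_le_one_right (by positivity) (Real.exp_le_one_iff.2 ?_)
        have : 0 ≤ Real.pi * δ ^ 2 * y ^ 2 := by positivity
        linarith
      have : 0 < δ * Real.exp (-(Real.pi * δ ^ 2) * y ^ 2) := by positivity
      linarith
    · rw [indicator_of_notMem (fun hm => hy1 hm.2), zero_add]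
      refine mul_le_mul_of_nonneg_right ?_ (Real.exp_pos _).le
      rw [inv_le_iff_one_le_mul₀ (by positivity)]
      rw [not_le, div_lt_iff₀ hδ] at hy1
      nlinarith
  · rw [integral_add hi1'.integrableOn hi2.integrableOn, integral_const_mul, integral_gaussian_Ioi,
      setIntegral_indicator measurableSet_Ioc, inter_eq_right.2 Ioc_subset_Ioi_self,
      ← intervalIntegral.integral_of_le hpos.le]
    have e1 : ∫ y in (0 : ℝ)..(1 / δ), (1 + y)⁻¹ = Real.log (1 + 1 / δ) := by
      have := intervalIntegral.integral_comp_add_left (a := 0) (b := 1 / δ)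
        (fun y : ℝ => y⁻¹) 1
      rw [this, add_zero, integral_inv_of_pos (by norm_num) (by positivity), div_one]
    have e2 : Real.sqrt (Real.pi / (Real.pi * δ ^ 2)) = 1 / δ := by
      rw [show Real.pi / (Real.pi * δ ^ 2) = (1 / δ) ^ 2 by field_simp,
        Real.sqrt_sq hpos.le]
    have e3 : Real.log (1 + 1 / δ) ≤ 2 * Real.log (1 / δ) := by
      rw [← Real.log_rpow hpos]
      refine Real.log_le_log (by positivity) ?_
      rw [Real.rpow_two]
      nlinarith
    rw [e1, e2]
    have e4 : δ * (1 / δ / 2) = 1 / 2 := by field_simp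
    rw [e4]
    nlinarith
  · apply le_of_eq
    congr 1
    ring

end Weight

end KakeyaGr

namespace KakeyaGr

/-! ### Measurability of the maximal function -/

section Measurability

variable {d n : ℕ}

/-- The interior of the plate `T_δ(σ)`. -/
def openPlate (δ : ℝ) (σ : Gr d n) : Set (E n) :=
  {ξ | ‖σ.proj ξ‖ < 1 ∧ ‖σ.projPerp ξ‖ < δ}

theorem isOpen_setOf_mem_openPlate (δ : ℝ) :
    IsOpen {p : Gr d n × E n | p.2 ∈ openPlate δ p.1} := by
  have h1 : Continuous fun p : Gr d n × E n => p.1.proj p.2 :=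
    (continuous_proj.comp continuous_fst).clm_apply continuous_snd
  have h2 : Continuous fun p : Gr d n × E n => p.1.projPerp p.2 :=
    (continuous_projPerp.comp continuous_fst).clm_apply continuous_snd
  exact (isOpen_lt h1.norm continuous_const).inter (isOpen_lt h2.norm continuous_const)

theorem isOpen_openPlate (δ : ℝ) (σ : Gr d n) : IsOpen (openPlate δ σ) :=
  (isOpen_setOf_mem_openPlate δ).preimage (Continuous.prodMk_right σ)

theorem convex_openPlate (δ : ℝ) (σ : Gr d n) : Convex ℝ (openPlate δ σ) := by
  have h1 : Convex ℝ (σ.proj ⁻¹' Metric.ball 0 1) :=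
    (convex_ball (0 : E n) 1).linear_preimage (σ.proj : E n →ₗ[ℝ] E n)
  have h2 : Convex ℝ (σ.projPerp ⁻¹' Metric.ball 0 δ) :=
    (convex_ball (0 : E n) δ).linear_preimage (σ.projPerp : E n →ₗ[ℝ] E n)
  convert h1.inter h2 using 1
  ext ξ
  simp [openPlate]

/-- A point of the plate is the limit of tξ as t ↑ 1, and these lie in the open plate. The frontier
of a convex set being null, the two plates agree almost everywhere. -/
theorem plate_diff_openPlate_subset (δ : ℝ) (σ : Gr d n) :
    plate δ σ \ openPlate δ σ ⊆ frontier (openPlate δ σ) := by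
  rintro ξ ⟨⟨h1, h2⟩, h3⟩
  rw [(isOpen_openPlate δ σ).frontier_eq]
  refine ⟨?_, h3⟩
  have ht : Filter.Tendsto (fun t : ℝ => t • ξ) (nhdsWithin 1 (Iio 1)) (nhds ξ) := by
    have : Filter.Tendsto (fun t : ℝ => t • ξ) (nhds 1) (nhds ((1 : ℝ) • ξ)) :=
      (continuous_id.smul continuous_const).tendsto 1
    rw [one_smul] at this
    exact this.mono_left nhdsWithin_le_nhds
  refine mem_closure_of_tendsto ht ?_
  filter_upwards [Ioo_mem_nhdsLT (show (0 : ℝ) < 1 by norm_num)] with t ht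
  constructor
  · rw [map_smul, norm_smul, Real.norm_of_nonneg ht.1.le]
    calc t * ‖σ.proj ξ‖ ≤ t * 1 := by gcongr; exact ht.1.le
      _ < 1 := by linarith [ht.2]
  · rw [map_smul, norm_smul, Real.norm_of_nonneg ht.1.le]
    exact (mul_le_of_le_one_left (norm_nonneg _) ht.2.le).trans_lt h2

theorem plate_ae_eq_openPlate (δ : ℝ) (σ : Gr d n) :
    plate δ σ =ᵐ[volume] openPlate δ σ := by
  have hsub : openPlate δ σ ⊆ plate δ σ := fun ξ h => ⟨h.1.le, h.2⟩
  refine Filter.EventuallyLE.antisymm ?_ hsub.eventuallyLE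
  rw [ae_le_set]
  exact measure_mono_null (plate_diff_openPlate_subset δ σ)
    ((convex_openPlate δ σ).addHaar_frontier volume)

theorem vadd_plate_ae_eq (δ : ℝ) (σ : Gr d n) (x : E n) :
    (x +ᵥ plate δ σ : Set (E n)) =ᵐ[volume] (x +ᵥ openPlate δ σ : Set (E n)) := by
  have h1 := (quasiMeasurePreserving_neg_vadd (μ := (volume : Measure (E n))) x).preimage_ae_eq
    (plate_ae_eq_openPlate δ σ)
  simpa only [preimage_neg_vadd] using h1
  where
  quasiMeasurePreserving_neg_vadd {μ : Measure (E n)} [μ.IsAddLeftInvariant] (x : E n) :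
      Measure.QuasiMeasurePreserving (fun y : E n => -x +ᵥ y) μ μ :=
    (measurePreserving_add_left μ (-x)).quasiMeasurePreserving
  preimage_neg_vadd {x : E n} {s : Set (E n)} :
      (fun y : E n => -x +ᵥ y) ⁻¹' s = x +ᵥ s := by
    ext y
    exact mem_vadd_set_iff_neg_vadd_mem.symm

/-- A point of an open plate stays in the plates of nearby subspaces, so the indicators are lower
semicontinuous in σ and Fatou's lemma applies. Lower semicontinuity survives the uncountable
supremum over x. -/
theorem lowerSemicontinuous_setLIntegral_openPlate (δ : ℝ) (x : E n) {φ : E n → ℝ≥0∞}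
    (hφ : AEMeasurable φ volume) :
    LowerSemicontinuous fun σ : Gr d n => ∫⁻ y in x +ᵥ openPlate δ σ, φ y := by
  intro σ
  have hm : ∀ τ : Gr d n, MeasurableSet (x +ᵥ openPlate δ τ) := fun τ =>
    ((isOpen_openPlate δ τ).measurableSet).const_vadd x
  refine lowerSemicontinuousAt_iff_le_liminf.2 ?_
  simp_rw [← lintegral_indicator (hm _)]
  refine le_trans (lintegral_mono fun y => ?_)
    (lintegral_liminf_le' fun τ => hφ.indicator (hm τ))
  by_cases hy : y ∈ x +ᵥ openPlate δ σ
  · have hev : ∀ᶠ τ in nhds σ, (x +ᵥ openPlate δ σ).indicator φ y ≤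
        (x +ᵥ openPlate δ τ).indicator φ y := by
      rw [mem_vadd_set_iff_neg_vadd_mem] at hy
      have ho : IsOpen {τ : Gr d n | -x +ᵥ y ∈ openPlate δ τ} :=
        (isOpen_setOf_mem_openPlate δ).preimage (Continuous.prodMk_left (-x +ᵥ y))
      filter_upwards [ho.mem_nhds hy] with τ hτ
      rw [indicator_of_mem (mem_vadd_set_iff_neg_vadd_mem.2 hτ),
        indicator_of_mem (mem_vadd_set_iff_neg_vadd_mem.2 hy)]
    exact Filter.le_liminf_of_le (by isBoundedDefault) hev
  · rw [indicator_of_notMem hy]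
    exact zero_le

theorem kakeya_eq (δ : ℝ) (f : E n → ℂ) (σ : Gr d n) :
    kakeya δ f σ = (volume (openPlate δ σ))⁻¹ *
      ⨆ x : E n, ∫⁻ y in x +ᵥ openPlate δ σ, ‖f y‖ₑ := by
  unfold kakeya
  rw [ENNReal.mul_iSup]
  refine iSup_congr fun x => ?_
  rw [setLAverage_eq, measure_vadd, ENNReal.div_eq_inv_mul,
    setLIntegral_congr (vadd_plate_ae_eq δ σ x), measure_congr (plate_ae_eq_openPlate δ σ)]

theorem measurable_kakeya (δ : ℝ) {f : E n → ℂ} (hf : AEStronglyMeasurable f volume) :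
    Measurable (kakeya (d := d) δ f) := by
  rw [show kakeya (d := d) δ f = _ from funext (kakeya_eq δ f)]
  refine Measurable.mul (Measurable.inv ?_) ?_
  · have h := (lowerSemicontinuous_setLIntegral_openPlate (d := d) δ (0 : E n)
      (φ := fun _ => 1) aemeasurable_const).measurable
    simpa using h
  · exact (lowerSemicontinuous_iSup fun x =>
      lowerSemicontinuous_setLIntegral_openPlate δ x hf.enorm).measurable

end Measurability

/-! ### Weighted Cauchy-Schwarz and the L² bound -/

section Bound

open scoped FourierTransform

variable {d n : ℕ}

/-- Cauchy-Schwarz for the measure with density g, applied to Φ w^(-1/2) and w^(1/2). -/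
theorem sq_lintegral_mul_le {α : Type*} [MeasurableSpace α] {μ : Measure α} {g Φ w : α → ℝ≥0∞}
    (hg : Measurable g) (hΦ : Measurable Φ) (hw : Measurable w) (hw0 : ∀ x, w x ≠ 0)
    (hwt : ∀ x, w x ≠ ∞) :
    (∫⁻ x, g x * Φ x ∂μ) ^ 2 ≤
      (∫⁻ x, g x * (Φ x ^ 2 * (w x)⁻¹) ∂μ) * ∫⁻ x, g x * w x ∂μ := by
  set a : α → ℝ≥0∞ := fun x => (g x * (Φ x ^ 2 * (w x)⁻¹)) ^ (1 / 2 : ℝ) with ha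
  set b : α → ℝ≥0∞ := fun x => (g x * w x) ^ (1 / 2 : ℝ) with hb
  have hsq : ∀ t : ℝ≥0∞, (t ^ (1 / 2 : ℝ)) ^ (2 : ℝ) = t := fun t => by
    rw [← ENNReal.rpow_mul]; norm_num
  have hab : ∀ x, (a * b) x = g x * Φ x := fun x => by
    rw [Pi.mul_apply, ha, hb]
    simp only
    rw [← ENNReal.mul_rpow_of_nonneg _ _ (by norm_num)]
    have : g x * (Φ x ^ 2 * (w x)⁻¹) * (g x * w x) = (g x * Φ x) ^ (2 : ℝ) := by
      rw [ENNReal.rpow_two]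
      calc g x * (Φ x ^ 2 * (w x)⁻¹) * (g x * w x)
          = (g x * Φ x) ^ 2 * ((w x)⁻¹ * w x) := by ring
        _ = (g x * Φ x) ^ 2 := by rw [ENNReal.inv_mul_cancel (hw0 x) (hwt x), mul_one]
    rw [this, ← ENNReal.rpow_mul]
    norm_num
  have h := ENNReal.lintegral_mul_le_Lp_mul_Lq μ Real.HolderConjugate.two_two
    (f := a) (g := b) (by fun_prop) (by fun_prop)
  simp_rw [hab, ha, hb, hsq] at h
  calc (∫⁻ x, g x * Φ x ∂μ) ^ 2
      ≤ ((∫⁻ x, g x * (Φ x ^ 2 * (w x)⁻¹) ∂μ) ^ (1 / 2 : ℝ) *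
          (∫⁻ x, g x * w x ∂μ) ^ (1 / 2 : ℝ)) ^ 2 := by gcongr
    _ = _ := by
      rw [mul_pow, ← ENNReal.rpow_two, ← ENNReal.rpow_two, hsq, hsq]

/-- A weighted Cauchy-Schwarz bound for the mean square of a family of integrals: if the mean of
`g ω` is at most `w` and the integral of `g ω` against `w` does not depend on `ω`, then the square
of the norm of the operator with kernel `g` is at most the integral of `w ^ 2`. -/
theorem lintegral_sq_lintegral_mul_le {Ω X : Type*} [MeasurableSpace Ω] [MeasurableSpace X]
    {μ : Measure Ω} [IsProbabilityMeasure μ] {ν : Measure X} [SFinite ν] {g : Ω → X → ℝ≥0∞}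
    {Φ w : X → ℝ≥0∞} {Y : ℝ≥0∞} (hg : Measurable fun p : Ω × X => g p.1 p.2) (hΦ : Measurable Φ)
    (hw : Measurable w) (hw0 : ∀ x, w x ≠ 0) (hwt : ∀ x, w x ≠ ∞)
    (hgw : ∀ x, ∫⁻ ω, g ω x ∂μ ≤ w x) (hY : ∀ ω, ∫⁻ x, g ω x * w x ∂ν = Y) :
    ∫⁻ ω, (∫⁻ x, g ω x * Φ x ∂ν) ^ 2 ∂μ ≤ (∫⁻ x, w x * w x ∂ν) * ∫⁻ x, Φ x ^ 2 ∂ν := by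
  have swap : ∀ {ψ : X → ℝ≥0∞}, Measurable ψ →
      ∫⁻ ω, (∫⁻ x, g ω x * ψ x ∂ν) ∂μ ≤ ∫⁻ x, w x * ψ x ∂ν := by
    intro ψ hψ
    rw [lintegral_lintegral_swap (hg.mul (hψ.comp measurable_snd)).aemeasurable]
    refine lintegral_mono fun x => ?_
    have hm : Measurable fun ω => g ω x := hg.comp measurable_prodMk_right
    rw [lintegral_mul_const _ hm]
    exact mul_le_mul_left (hgw x) _
  -- Y, being constant in ω, equals its own mean, and the mean of g is at most w.
  have hYle : Y ≤ ∫⁻ x, w x * w x ∂ν := by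
    calc Y = ∫⁻ _ω, Y ∂μ := by simp
      _ = ∫⁻ ω, (∫⁻ x, g ω x * w x ∂ν) ∂μ := lintegral_congr fun ω => (hY ω).symm
      _ ≤ _ := swap hw
  have hψm : Measurable fun x => Φ x ^ 2 * (w x)⁻¹ := (hΦ.pow_const 2).mul hw.inv
  calc ∫⁻ ω, (∫⁻ x, g ω x * Φ x ∂ν) ^ 2 ∂μ
      ≤ ∫⁻ ω, (∫⁻ x, g ω x * (Φ x ^ 2 * (w x)⁻¹) ∂ν) * Y ∂μ := by
        refine lintegral_mono fun ω => ?_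
        rw [← hY ω]
        exact sq_lintegral_mul_le (hg.comp measurable_prodMk_left) hΦ hw hw0 hwt
    _ = (∫⁻ ω, (∫⁻ x, g ω x * (Φ x ^ 2 * (w x)⁻¹) ∂ν) ∂μ) * Y := by
        rw [lintegral_mul_const]
        exact (hg.mul (hψm.comp measurable_snd)).lintegral_prod_right'
    _ ≤ (∫⁻ x, w x * (Φ x ^ 2 * (w x)⁻¹) ∂ν) * Y := mul_le_mul_left (swap hψm) _
    _ = (∫⁻ x, Φ x ^ 2 ∂ν) * Y := by
        congr 1
        refine lintegral_congr fun x => ?_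
        rw [mul_comm, mul_assoc, ENNReal.inv_mul_cancel (hw0 x) (hwt x), mul_one]
    _ ≤ _ := by
        rw [mul_comm]
        exact mul_le_mul_left hYle _

/-- A majorant of the mean of the Gaussians adapted to the dual plates. -/
noncomputable def weight (d : ℕ) (C δ y : ℝ) : ℝ :=
  C * ((1 + y) ^ d)⁻¹ * Real.exp (-(Real.pi / 2 * δ ^ 2) * y ^ 2)

theorem weight_pos {C : ℝ} (hC : 0 < C) (δ : ℝ) {y : ℝ} (hy : 0 ≤ y) : 0 < weight d C δ y := by
  unfold weight
  positivity

theorem sq_weight (C δ y : ℝ) : weight d C δ y ^ 2 = C ^ 2 * sqWeight d δ y := by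
  rw [weight, sqWeight, mul_pow, mul_pow, ← Real.exp_nat_mul, inv_pow, ← pow_mul, mul_comm d 2,
    mul_assoc]
  congr 3
  push_cast
  ring

theorem norm_sq_projPerp (σ : Gr d n) (x : E n) :
    ‖σ.1ᗮ.starProjection x‖ ^ 2 = ‖x‖ ^ 2 - ‖σ.proj x‖ ^ 2 := by
  rw [Submodule.norm_sq_eq_add_norm_sq_starProjection x σ.1, Gr.proj]
  ring

theorem plateGaussian_eq (σ : Gr d n) (δ : ℝ) (ξ : E n) :
    plateGaussian σ.1 δ ξ =
      Real.exp (-Real.pi * (‖σ.proj ξ‖ ^ 2 + δ ^ 2 * (‖ξ‖ ^ 2 - ‖σ.proj ξ‖ ^ 2))) := by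
  rw [plateGaussian, norm_sq_orthDilation, norm_sq_projPerp, Gr.proj]

theorem continuous_plateGaussian_rot (h : d ≤ n) (δ : ℝ) :
    Continuous fun p : O n × E n => plateGaussian (rot h p.1).1 δ p.2 := by
  simp_rw [plateGaussian_eq]
  have h1 := (continuous_rot_proj h).norm.pow 2
  have h2 : Continuous fun p : O n × E n => ‖p.2‖ ^ 2 := continuous_snd.norm.pow 2
  exact Real.continuous_exp.comp
    (continuous_const.mul (h1.add (continuous_const.mul (h2.sub h1))))

/-- For δ ≤ 1 the exponent |Πξ|² + δ²(|ξ|² - |Πξ|²) is at least half of |Πξ|² + δ²|ξ|²: half of the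
decay feeds the mean over subspaces, half gives a radial cutoff at scale 1/δ. -/
theorem lintegral_plateGaussian_rot_le (h : d ≤ n) {C δ : ℝ} (hδ0 : 0 < δ) (hδ1 : δ ≤ 1)
    (hC : ∀ ξ : E n, meanGaussian h ξ ≤ ENNReal.ofReal (C * ((1 + ‖ξ‖) ^ d)⁻¹)) (ξ : E n) :
    ∫⁻ ω, ENNReal.ofReal (plateGaussian (rot h ω).1 δ ξ) ∂haarO n ≤
      ENNReal.ofReal (weight d C δ ‖ξ‖) := by
  calc ∫⁻ ω, ENNReal.ofReal (plateGaussian (rot h ω).1 δ ξ) ∂haarO n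
      ≤ ∫⁻ ω, ENNReal.ofReal (Real.exp (-(Real.pi / 2) * ‖(rot h ω).proj ξ‖ ^ 2)) *
          ENNReal.ofReal (Real.exp (-(Real.pi / 2 * δ ^ 2) * ‖ξ‖ ^ 2)) ∂haarO n := by
        refine lintegral_mono fun ω => ?_
        rw [← ENNReal.ofReal_mul (Real.exp_pos _).le, ← Real.exp_add]
        refine ENNReal.ofReal_le_ofReal ?_
        rw [plateGaussian_eq]
        refine Real.exp_le_exp.2 ?_
        have hP : ‖(rot h ω).proj ξ‖ ^ 2 ≤ ‖ξ‖ ^ 2 := by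
          have := norm_sq_projPerp (rot h ω) ξ
          nlinarith [sq_nonneg ‖(rot h ω).1ᗮ.starProjection ξ‖]
        have hδ2 : δ ^ 2 ≤ 1 := pow_le_one₀ hδ0.le hδ1
        have hpi := Real.pi_pos
        have h1 : 0 ≤ (1 - δ ^ 2) * ‖(rot h ω).proj ξ‖ ^ 2 :=
          mul_nonneg (by linarith) (sq_nonneg _)
        have h2 : 0 ≤ δ ^ 2 * (‖ξ‖ ^ 2 - ‖(rot h ω).proj ξ‖ ^ 2) :=
          mul_nonneg (sq_nonneg _) (by linarith)
        have h3 := mul_nonneg hpi.le (add_nonneg h1 h2)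
        nlinarith
    _ = meanGaussian h ξ * ENNReal.ofReal (Real.exp (-(Real.pi / 2 * δ ^ 2) * ‖ξ‖ ^ 2)) := by
        rw [lintegral_mul_const' _ _ ENNReal.ofReal_ne_top, meanGaussian]
    _ ≤ ENNReal.ofReal (C * ((1 + ‖ξ‖) ^ d)⁻¹) *
          ENNReal.ofReal (Real.exp (-(Real.pi / 2 * δ ^ 2) * ‖ξ‖ ^ 2)) := by
        gcongr
        exact hC ξ
    _ = _ := by rw [← ENNReal.ofReal_mul' (Real.exp_pos _).le, weight]

theorem lintegral_plateGaussian_rot_mul_norm (h : d ≤ n) (δ : ℝ) (ω : O n) {φ : ℝ → ℝ≥0∞}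
    (hφ : Measurable φ) :
    ∫⁻ ξ : E n, ENNReal.ofReal (plateGaussian (rot h ω).1 δ ξ) * φ ‖ξ‖ =
      ∫⁻ ξ : E n, ENNReal.ofReal (plateGaussian (stdSubspace h) δ ξ) * φ ‖ξ‖ := by
  have hmp := (Unitary.linearIsometryEquiv ω).symm.measurePreserving
  have hm : Measurable fun ξ : E n =>
      ENNReal.ofReal (plateGaussian (stdSubspace h) δ ξ) * φ ‖ξ‖ :=
    (ENNReal.measurable_ofReal.comp (continuous_plateGaussian (stdSubspace h) δ).measurable).mul
      (hφ.comp measurable_norm)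
  rw [← hmp.lintegral_comp hm]
  refine lintegral_congr fun ξ => ?_
  have e : plateGaussian (rot h ω).1 δ ξ =
      plateGaussian (stdSubspace h) δ ((Unitary.linearIsometryEquiv ω).symm ξ) := by
    have h2 := plateGaussian_eq (⟨stdSubspace h, finrank_stdSubspace h⟩ : Gr d n) δ
      ((Unitary.linearIsometryEquiv ω).symm ξ)
    rw [h2, plateGaussian_eq, norm_rot_proj, LinearIsometryEquiv.norm_map]
    rfl
  rw [e, LinearIsometryEquiv.norm_map]

theorem lintegral_sq_gaussian_mean_le (h : d ≤ n) {C δ : ℝ} (hC0 : 0 < C) (hδ0 : 0 < δ)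
    (hδ1 : δ ≤ 1)
    (hC : ∀ ξ : E n, meanGaussian h ξ ≤ ENNReal.ofReal (C * ((1 + ‖ξ‖) ^ d)⁻¹))
    {Φ : E n → ℝ≥0∞} (hΦ : Measurable Φ) :
    ∫⁻ ω, (∫⁻ ξ, ENNReal.ofReal (plateGaussian (rot h ω).1 δ ξ) * Φ ξ) ^ 2 ∂haarO n ≤
      (ENNReal.ofReal (C ^ 2) * ∫⁻ ξ : E n, ENNReal.ofReal (sqWeight d δ ‖ξ‖)) *
        ∫⁻ ξ, Φ ξ ^ 2 := by
  have hφm : Measurable fun y => ENNReal.ofReal (weight d C δ y) := by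
    refine ENNReal.measurable_ofReal.comp ?_
    unfold weight
    fun_prop
  have key := lintegral_sq_lintegral_mul_le (μ := haarO n) (ν := (volume : Measure (E n)))
    (g := fun ω ξ => ENNReal.ofReal (plateGaussian (rot h ω).1 δ ξ))
    (w := fun ξ => ENNReal.ofReal (weight d C δ ‖ξ‖))
    (ENNReal.measurable_ofReal.comp (continuous_plateGaussian_rot h δ).measurable) hΦ
    (hφm.comp measurable_norm)
    (fun ξ => (ENNReal.ofReal_pos.2 (weight_pos hC0 δ (norm_nonneg _))).ne')
    (fun ξ => ENNReal.ofReal_ne_top) (lintegral_plateGaussian_rot_le h hδ0 hδ1 hC)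
    (fun ω => lintegral_plateGaussian_rot_mul_norm h δ ω hφm)
  refine key.trans (le_of_eq ?_)
  congr 1
  rw [← lintegral_const_mul' _ _ ENNReal.ofReal_ne_top]
  refine lintegral_congr fun ξ => ?_
  rw [← ENNReal.ofReal_mul (weight_pos hC0 δ (norm_nonneg _)).le, ← sq, sq_weight,
    ENNReal.ofReal_mul (by positivity)]

theorem lintegral_sq_kakeya_le_of_integrable (h : d ≤ n) {C δ : ℝ} (hC0 : 0 < C) (hδ0 : 0 < δ)
    (hδ1 : δ ≤ 1)
    (hC : ∀ ξ : E n, meanGaussian h ξ ≤ ENNReal.ofReal (C * ((1 + ‖ξ‖) ^ d)⁻¹))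
    {f : E n → ℂ} (hf : Integrable f) (hf2 : MemLp f 2 volume) :
    ∫⁻ σ, kakeya δ f σ ^ 2 ∂grMeasure h ≤
      gaussianConst (E n) ^ 2 *
        ((ENNReal.ofReal (C ^ 2) * ∫⁻ ξ : E n, ENNReal.ofReal (sqWeight d δ ‖ξ‖)) *
        ∫⁻ x, ‖f x‖ₑ ^ 2) := by
  set F : E n → ℂ := fun y => ((‖f y‖ : ℝ) : ℂ) with hF
  have hFi : Integrable F := hf.norm.ofReal
  have hF2 : MemLp F 2 volume := hf2.norm.ofReal
  have hcont : Continuous (𝓕 F) := continuous_fourier hFi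
  have hk : ∀ σ : Gr d n, kakeya δ f σ ≤ gaussianConst (E n) *
      ∫⁻ ξ, ENNReal.ofReal (plateGaussian σ.1 δ ξ) * ‖𝓕 F ξ‖ₑ := fun σ => by
    refine iSup_le fun x => ?_
    have := laverage_plate_le σ.1 hδ0 hf.norm (fun y => norm_nonneg _) x
    simp only [ofReal_norm] at this
    exact this
  rw [grMeasure, lintegral_map ((measurable_kakeya δ hf.aestronglyMeasurable).pow_const 2)
    (continuous_rot h).measurable]
  calc ∫⁻ ω, kakeya δ f (rot h ω) ^ 2 ∂haarO n
      ≤ ∫⁻ ω, gaussianConst (E n) ^ 2 *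
        (∫⁻ ξ, ENNReal.ofReal (plateGaussian (rot h ω).1 δ ξ) * ‖𝓕 F ξ‖ₑ) ^ 2 ∂haarO n := by
        refine lintegral_mono fun ω => ?_
        rw [← mul_pow]
        gcongr
        exact hk _
    _ = gaussianConst (E n) ^ 2 * ∫⁻ ω,
        (∫⁻ ξ, ENNReal.ofReal (plateGaussian (rot h ω).1 δ ξ) * ‖𝓕 F ξ‖ₑ) ^ 2 ∂haarO n :=
        lintegral_const_mul' _ _ (ENNReal.pow_ne_top gaussianConst_lt_top.ne)
    _ ≤ gaussianConst (E n) ^ 2 *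
        ((ENNReal.ofReal (C ^ 2) * ∫⁻ ξ : E n, ENNReal.ofReal (sqWeight d δ ‖ξ‖)) *
        ∫⁻ ξ, ‖𝓕 F ξ‖ₑ ^ 2) := by
        gcongr
        exact lintegral_sq_gaussian_mean_le h hC0 hδ0 hδ1 hC hcont.enorm.measurable
    _ ≤ _ := by
        refine mul_le_mul_right (mul_le_mul_right ?_ _) _
        refine (lintegral_enorm_sq_fourier_le hFi hF2).trans (le_of_eq ?_)
        refine lintegral_congr fun x => ?_
        rw [hF, ← ofReal_norm, Complex.norm_real, norm_norm, ofReal_norm]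

theorem kakeya_mono (δ : ℝ) {f g : E n → ℂ} (hfg : ∀ x, ‖f x‖ₑ ≤ ‖g x‖ₑ) (σ : Gr d n) :
    kakeya δ f σ ≤ kakeya δ g σ :=
  iSup_mono fun _ => lintegral_mono fun y => hfg y

theorem kakeya_eq_iSup_indicator (δ : ℝ) {f : E n → ℂ} (hf : AEStronglyMeasurable f volume)
    (σ : Gr d n) :
    kakeya δ f σ = ⨆ k : ℕ, kakeya δ ((Metric.closedBall 0 (k : ℝ)).indicator f) σ := by
  unfold kakeya
  rw [iSup_comm]
  refine iSup_congr fun x => ?_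
  simp_rw [setLAverage_eq]
  rw [← ENNReal.iSup_div, ← lintegral_iSup']
  · congr 1
    refine lintegral_congr fun y => ?_
    refine le_antisymm ?_ (iSup_le fun k => ?_)
    · obtain ⟨k, hk⟩ := exists_nat_ge ‖y‖
      refine le_iSup_of_le k ?_
      rw [indicator_of_mem (by simpa using hk)]
    · rw [enorm_indicator_eq_indicator_enorm]
      exact indicator_le_self _ _ _
  · intro k
    exact (hf.indicator Metric.isClosed_closedBall.measurableSet).enorm.restrict
  · refine .of_forall fun y => ?_
    intro j k hjk
    simp only [enorm_indicator_eq_indicator_enorm]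
    refine indicator_le_indicator_of_subset ?_ (fun _ => zero_le) y
    exact Metric.closedBall_subset_closedBall (by exact_mod_cast hjk)

/-- Truncating f to balls makes it integrable, as the Fourier argument requires; monotone
convergence removes the truncation. -/
theorem lintegral_sq_kakeya_le (h : d ≤ n) {C δ : ℝ} (hC0 : 0 < C) (hδ0 : 0 < δ)
    (hδ1 : δ ≤ 1)
    (hC : ∀ ξ : E n, meanGaussian h ξ ≤ ENNReal.ofReal (C * ((1 + ‖ξ‖) ^ d)⁻¹))
    {f : E n → ℂ} (hf2 : MemLp f 2 volume) :
    ∫⁻ σ, kakeya δ f σ ^ 2 ∂grMeasure h ≤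
      gaussianConst (E n) ^ 2 *
        ((ENNReal.ofReal (C ^ 2) * ∫⁻ ξ : E n, ENNReal.ofReal (sqWeight d δ ‖ξ‖)) *
        ∫⁻ x, ‖f x‖ₑ ^ 2) := by
  have hm : ∀ k : ℕ, MeasurableSet (Metric.closedBall (0 : E n) (k : ℝ)) := fun k =>
    Metric.isClosed_closedBall.measurableSet
  have hle : ∀ (k : ℕ) (y : E n),
      ‖(Metric.closedBall 0 (k : ℝ)).indicator f y‖ₑ ≤ ‖f y‖ₑ := fun k y => by
    rw [enorm_indicator_eq_indicator_enorm]
    exact indicator_le_self _ _ _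
  have hmono : ∀ σ : Gr d n, Monotone fun k : ℕ =>
      kakeya δ ((Metric.closedBall 0 (k : ℝ)).indicator f) σ := by
    intro σ j k hjk
    refine kakeya_mono δ (fun y => ?_) σ
    simp only [enorm_indicator_eq_indicator_enorm]
    refine indicator_le_indicator_of_subset ?_ (fun _ => zero_le) y
    exact Metric.closedBall_subset_closedBall (by exact_mod_cast hjk)
  have e1 : ∀ σ : Gr d n, kakeya δ f σ ^ 2 =
      ⨆ k : ℕ, kakeya δ ((Metric.closedBall 0 (k : ℝ)).indicator f) σ ^ 2 := fun σ => by
    rw [kakeya_eq_iSup_indicator δ hf2.1, ENNReal.iSup_pow]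
  simp_rw [e1]
  rw [lintegral_iSup]
  · refine iSup_le fun k => ?_
    have hk2 : MemLp ((Metric.closedBall 0 (k : ℝ)).indicator f) 2 volume := hf2.indicator (hm k)
    have hk1 : Integrable ((Metric.closedBall 0 (k : ℝ)).indicator f) := by
      rw [integrable_indicator_iff (hm k)]
      have : IsFiniteMeasure (volume.restrict (Metric.closedBall (0 : E n) (k : ℝ))) :=
        ⟨by rw [Measure.restrict_apply_univ]; exact measure_closedBall_lt_top⟩
      exact (hf2.restrict _).integrable (by norm_num)
    refine (lintegral_sq_kakeya_le_of_integrable h hC0 hδ0 hδ1 hC hk1 hk2).trans ?_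
    gcongr with x
    exact hle k x
  · intro k
    exact (measurable_kakeya δ (hf2.1.indicator (hm k))).pow_const 2
  · intro j k hjk σ
    exact pow_le_pow_left' (hmono σ hjk) 2

theorem sq_eLpNorm_two {α ε : Type*} [MeasurableSpace α] [TopologicalSpace ε] [ContinuousENorm ε]
    (f : α → ε) (μ : Measure α) : eLpNorm f 2 μ ^ 2 = ∫⁻ x, ‖f x‖ₑ ^ 2 ∂μ := by
  rw [eLpNorm_eq_lintegral_rpow_enorm_toReal (by norm_num) (by norm_num), ← ENNReal.rpow_two,
    ← ENNReal.rpow_mul]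
  norm_num

/-- The `L²` norm of the maximal function is controlled by the integral of the squared weight. -/
theorem exists_kakeyaNormLE (h : d ≤ n) :
    ∃ M : ℝ, 0 < M ∧ ∀ δ A B : ℝ, 0 < δ → δ ≤ 1 → 0 ≤ A → 0 ≤ B →
      ∫⁻ ξ : E n, ENNReal.ofReal (sqWeight d δ ‖ξ‖) ≤ ENNReal.ofReal (A * B ^ 2) →
      KakeyaNormLE h δ (M * Real.sqrt A * B) := by
  obtain ⟨C, hC0, hC⟩ := exists_meanGaussian_le h
  have hg0 : 0 < gaussianConst (E n) := by
    refine ENNReal.mul_pos (ENNReal.ofReal_pos.2 (Real.exp_pos _)).ne' ?_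
    exact ENNReal.inv_ne_zero.2 measure_ball_lt_top.ne
  have hgt := gaussianConst_lt_top (V := E n)
  -- The squared norm is at most `gaussianConst`² C² A B²; this is its square root once √A and B are
  -- split off, B carrying the dependence on δ.
  refine ⟨(gaussianConst (E n)).toReal * C, mul_pos (ENNReal.toReal_pos hg0.ne' hgt.ne) hC0,
    fun δ A B hδ0 hδ1 hA hB hW f hf => ⟨?_, ?_⟩⟩
  · exact (measurable_kakeya δ hf.1).aestronglyMeasurable
  · refine (ENNReal.pow_le_pow_left_iff two_ne_zero).1 ?_
    rw [mul_pow, sq_eLpNorm_two, sq_eLpNorm_two]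
    simp only [enorm_eq_self]
    refine (lintegral_sq_kakeya_le h hC0 hδ0 hδ1 hC hf).trans ?_
    rw [← mul_assoc]
    gcongr
    calc gaussianConst (E n) ^ 2 *
          (ENNReal.ofReal (C ^ 2) * ∫⁻ ξ : E n, ENNReal.ofReal (sqWeight d δ ‖ξ‖))
        ≤ gaussianConst (E n) ^ 2 * (ENNReal.ofReal (C ^ 2) * ENNReal.ofReal (A * B ^ 2)) := by
          gcongr
      _ = _ := by
          rw [← ENNReal.ofReal_toReal hgt.ne, ← ENNReal.ofReal_pow ENNReal.toReal_nonneg,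
            ← ENNReal.ofReal_mul (by positivity), ← ENNReal.ofReal_mul (by positivity),
            ← ENNReal.ofReal_pow (by positivity), ENNReal.toReal_ofReal ENNReal.toReal_nonneg]
          congr 1
          rw [mul_pow, mul_pow, mul_pow, Real.sq_sqrt hA]
          ring

end Bound

end KakeyaGr

namespace KakeyaGr

/-! ### Absence of Besicovitch sets -/

section Besicovitch

variable {d n : ℕ}

theorem volume_plate_ne_zero {δ : ℝ} (hδ : 0 < δ) (σ : Gr d n) : volume (plate δ σ) ≠ 0 := by
  rw [measure_congr (plate_ae_eq_openPlate δ σ)]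
  refine ((isOpen_openPlate δ σ).measure_pos volume ⟨0, ?_⟩).ne'
  simpa [openPlate] using hδ

theorem volume_plate_ne_top (δ : ℝ) (σ : Gr d n) : volume (plate δ σ) ≠ ∞ := by
  refine ne_top_of_le_ne_top (measure_closedBall_lt_top (x := (0 : E n)) (r := 1 + δ)).ne
    (measure_mono fun ξ hξ => ?_)
  rw [mem_closedBall_zero_iff]
  have h : σ.proj ξ + σ.projPerp ξ = ξ :=
    Submodule.starProjection_add_starProjection_orthogonal (K := σ.1) ξ
  calc ‖ξ‖ = ‖σ.proj ξ + σ.projPerp ξ‖ := by rw [h]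
    _ ≤ ‖σ.proj ξ‖ + ‖σ.projPerp ξ‖ := norm_add_le _ _
    _ ≤ 1 + δ := add_le_add hξ.1 hξ.2.le

theorem half_smul_plate_subset {δ : ℝ} (σ : Gr d n) :
    (1 / 2 : ℝ) • plate δ σ ⊆ plate δ σ := by
  rintro _ ⟨ξ, hξ, rfl⟩
  have h2 : ‖(1 / 2 : ℝ)‖ = 1 / 2 := by norm_num
  constructor
  · simp only [map_smul, norm_smul, h2]
    linarith [hξ.1, norm_nonneg (σ.proj ξ)]
  · simp only [map_smul, norm_smul, h2]
    linarith [hξ.2, norm_nonneg (σ.projPerp ξ)]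

/-- If `U` contains a translate of the half-size plate, then the maximal function of the
indicator function of `U` is bounded below. -/
theorem le_kakeya_indicator {U : Set (E n)} (hU : MeasurableSet U) {δ : ℝ} (hδ : 0 < δ)
    {σ : Gr d n} {y : E n} (h : y +ᵥ (1 / 2 : ℝ) • plate δ σ ⊆ U) :
    ENNReal.ofReal ((1 / 2) ^ n) ≤ kakeya δ (U.indicator fun _ => 1) σ := by
  refine le_trans ?_ (le_iSup _ y)
  have hT0 := volume_plate_ne_zero hδ σ
  have hTt := volume_plate_ne_top δ σ
  rw [setLAverage_eq, measure_vadd, ENNReal.le_div_iff_mul_le (.inl hT0) (.inl hTt)]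
  have e1 : ENNReal.ofReal ((1 / 2) ^ n) * volume (plate δ σ) =
      volume (y +ᵥ (1 / 2 : ℝ) • plate δ σ) := by
    rw [measure_vadd, Measure.addHaar_smul, finrank_euclideanSpace_fin,
      abs_of_nonneg (by positivity)]
  rw [e1]
  calc volume (y +ᵥ (1 / 2 : ℝ) • plate δ σ)
      ≤ volume (U ∩ (y +ᵥ plate δ σ)) :=
        measure_mono (subset_inter h (vadd_set_mono (half_smul_plate_subset σ)))
    _ = ∫⁻ x in y +ᵥ plate δ σ, U.indicator (fun _ => 1) x := by
        rw [lintegral_indicator_const hU, one_mul, Measure.restrict_apply hU]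
    _ = _ := by
        refine lintegral_congr fun x => ?_
        rw [enorm_indicator_eq_indicator_enorm, enorm_one]

/-- The given disc is open; halving the radius makes it compact, so that a whole neighbourhood of
it, containing all thin half-size plates, lies in U. The threshold η depends on σ, hence the later
use of Fatou's lemma. -/
theorem exists_vadd_half_plate_subset {U : Set (E n)} (hU : IsOpen U) (σ : Gr d n) {y : E n}
    (h : Metric.ball y 1 ∩ (y +ᵥ (σ.1 : Set (E n))) ⊆ U) :
    ∃ η : ℝ, 0 < η ∧ ∀ δ : ℝ, δ < η → y +ᵥ (1 / 2 : ℝ) • plate δ σ ⊆ U := by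
  have hcl : IsClosed (y +ᵥ (σ.1 : Set (E n))) := σ.1.closed_of_finiteDimensional.vadd y
  have hS : IsCompact (Metric.closedBall y (1 / 2) ∩ (y +ᵥ (σ.1 : Set (E n)))) :=
    (isCompact_closedBall y (1 / 2)).inter_right hcl
  obtain ⟨η, hη, hsub⟩ := hS.exists_thickening_subset_open hU
    ((inter_subset_inter_left _ (Metric.closedBall_subset_ball (by norm_num))).trans h)
  refine ⟨η, hη, fun δ hδ => ?_⟩
  rintro _ ⟨_, ⟨ξ, hξ, rfl⟩, rfl⟩
  refine hsub (Metric.mem_thickening_iff.2 ⟨y + (1 / 2 : ℝ) • σ.proj ξ, ⟨?_, ?_⟩, ?_⟩)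
  · rw [Metric.mem_closedBall, dist_eq_norm, add_sub_cancel_left, norm_smul]
    norm_num
    linarith [hξ.1]
  · exact ⟨_, σ.1.smul_mem _ (Submodule.starProjection_apply_mem σ.1 ξ), rfl⟩
  · have e : σ.proj ξ + σ.projPerp ξ = ξ :=
      Submodule.starProjection_add_starProjection_orthogonal (K := σ.1) ξ
    have e2 : ξ - σ.proj ξ = σ.projPerp ξ := by rw [sub_eq_iff_eq_add', e]
    simp only [vadd_eq_add]
    rw [dist_eq_norm, add_sub_add_left_eq_sub, ← smul_sub, e2, norm_smul]
    norm_num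
    linarith [hξ.2, norm_nonneg (σ.projPerp ξ)]

theorem not_isBesicovitch_of_kakeyaNormLE (h : d ≤ n) {C : ℝ} (hC : 0 < C)
    (hK : ∀ δ : ℝ, 0 < δ → δ < 1 → KakeyaNormLE h δ C) (A : Set (E n)) :
    ¬ IsBesicovitch d n A := by
  rintro ⟨⟨-, hA⟩, hA0⟩
  set c : ℝ := ((1 / 2) ^ n) ^ 2 with hc
  have hc0 : 0 < c := by positivity
  -- Chosen so that C² |U| ≤ c/2, half of the lower bound c for the squared maximal function.
  set ε : ℝ := c / (2 * C ^ 2) with hε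
  have hε0 : 0 < ε := by positivity
  obtain ⟨U, hAU, hU, hUε⟩ := A.exists_isOpen_lt_of_lt (ENNReal.ofReal ε)
    (by rw [hA0]; exact ENNReal.ofReal_pos.2 hε0)
  set f : E n → ℂ := U.indicator fun _ => 1 with hf
  have hfL : MemLp f 2 volume := memLp_indicator_const 2 hU.measurableSet 1 (.inr hUε.ne_top)
  have hfn : ∫⁻ x, ‖f x‖ₑ ^ 2 = volume U := by
    have e : ∀ x, ‖f x‖ₑ ^ 2 = U.indicator (fun _ => 1) x := fun x => by
      by_cases hx : x ∈ U <;> simp [hf, hx]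
    simp_rw [e]
    rw [lintegral_indicator_const hU.measurableSet, one_mul]
  -- The shift by 2 keeps δ below 1 at k = 0 too.
  let δ : ℕ → ℝ := fun k => 1 / ((k : ℝ) + 2)
  have hδ0 : ∀ k, 0 < δ k := fun k => by positivity
  have hδ1 : ∀ k, δ k < 1 := fun k => by
    have : (0 : ℝ) ≤ k := Nat.cast_nonneg k
    rw [div_lt_one (by positivity)]
    linarith
  have hδt : Filter.Tendsto δ Filter.atTop (nhds 0) := by
    have h1 : Filter.Tendsto (fun k : ℕ => (k : ℝ) + 2) Filter.atTop Filter.atTop :=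
      Filter.tendsto_atTop_add_const_right _ _ tendsto_natCast_atTop_atTop
    exact tendsto_const_nhds.div_atTop h1
  have hlow : ∀ σ : Gr d n, ENNReal.ofReal c ≤
      Filter.liminf (fun k => kakeya (δ k) f σ ^ 2) Filter.atTop := by
    intro σ
    obtain ⟨y, hy⟩ := hA σ
    obtain ⟨η, hη, hsub⟩ := exists_vadd_half_plate_subset hU σ (hy.trans hAU)
    refine Filter.le_liminf_of_le (by isBoundedDefault) ?_
    filter_upwards [hδt.eventually_lt_const hη] with k hk
    rw [hc, ENNReal.ofReal_pow (by positivity)]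
    exact pow_le_pow_left' (le_kakeya_indicator hU.measurableSet (hδ0 k) (hsub _ hk)) 2
  have hup : ∀ k, ∫⁻ σ, kakeya (δ k) f σ ^ 2 ∂grMeasure h ≤ ENNReal.ofReal (c / 2) := by
    intro k
    have h1 := (hK (δ k) (hδ0 k) (hδ1 k) f hfL).2
    have h2 := pow_le_pow_left' h1 2
    rw [mul_pow, sq_eLpNorm_two, sq_eLpNorm_two, hfn] at h2
    simp only [enorm_eq_self] at h2
    refine h2.trans ?_
    calc ENNReal.ofReal C ^ 2 * volume U ≤ ENNReal.ofReal C ^ 2 * ENNReal.ofReal ε := by gcongr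
      _ = ENNReal.ofReal (c / 2) := by
        rw [← ENNReal.ofReal_pow hC.le, ← ENNReal.ofReal_mul (by positivity), hε]
        congr 1
        field_simp
  have hfin : ENNReal.ofReal c ≤ ENNReal.ofReal (c / 2) := by
    calc ENNReal.ofReal c = ∫⁻ _σ : Gr d n, ENNReal.ofReal c ∂grMeasure h := by simp
      _ ≤ ∫⁻ σ, Filter.liminf (fun k => kakeya (δ k) f σ ^ 2) Filter.atTop ∂grMeasure h :=
          lintegral_mono hlow
      _ ≤ Filter.liminf (fun k => ∫⁻ σ, kakeya (δ k) f σ ^ 2 ∂grMeasure h) Filter.atTop :=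
          lintegral_liminf_le fun k => (measurable_kakeya (δ k) hfL.1).pow_const 2
      _ ≤ _ := Filter.liminf_le_of_frequently_le' (Filter.Frequently.of_forall hup)
  rw [ENNReal.ofReal_le_ofReal_iff (by positivity)] at hfin
  linarith

end Besicovitch

end KakeyaGr

theorem mainTheorem9 (d n : ℕ) (hd : 1 ≤ d) (hdn : d < n) :
    (n < 2 * d → ∃ C : ℝ, 0 < C ∧ ∀ δ : ℝ, 0 < δ → δ < 1 →
        KakeyaGr.KakeyaNormLE hdn.le δ C) ∧
    (2 * d = n → ∃ C : ℝ, 0 < C ∧ ∀ δ : ℝ, 0 < δ → δ ≤ 1 / 2 →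
        KakeyaGr.KakeyaNormLE hdn.le δ (C * Real.log (1 / δ))) ∧
    (2 * d < n → ∃ C : ℝ, 0 < C ∧ ∀ δ : ℝ, 0 < δ → δ < 1 →
        KakeyaGr.KakeyaNormLE hdn.le δ (C * δ ^ ((d : ℝ) - (n : ℝ) / 2))) ∧
    (n < 2 * d → ¬ ∃ A : Set (KakeyaGr.E n), KakeyaGr.IsBesicovitch d n A) := by
  obtain ⟨M, hM, hK⟩ := KakeyaGr.exists_kakeyaNormLE hdn.le
  have hlarge : n < 2 * d → ∃ C : ℝ, 0 < C ∧ ∀ δ : ℝ, 0 < δ → δ < 1 →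
      KakeyaGr.KakeyaNormLE hdn.le δ C := by
    intro h
    obtain ⟨A, hA, hW⟩ := KakeyaGr.exists_lintegral_sqWeight_le_of_lt h
    refine ⟨M * Real.sqrt A, mul_pos hM (Real.sqrt_pos.2 hA), fun δ hδ hδ1 => ?_⟩
    have := hK δ A 1 hδ hδ1.le hA.le zero_le_one (by simpa using hW δ)
    rwa [mul_one] at this
  refine ⟨hlarge, fun h => ?_, fun h => ?_, fun h => ?_⟩
  · obtain ⟨A, hA, hW⟩ := KakeyaGr.exists_lintegral_sqWeight_le_of_eq hd h
    refine ⟨M * Real.sqrt A, mul_pos hM (Real.sqrt_pos.2 hA), fun δ hδ hδ1 => ?_⟩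
    refine hK δ A _ hδ (by linarith) hA.le (Real.log_nonneg ?_) (hW δ hδ hδ1)
    rw [le_div_iff₀ hδ]
    linarith
  · obtain ⟨A, hA, hW⟩ := KakeyaGr.exists_lintegral_sqWeight_le_of_gt h
    refine ⟨M * Real.sqrt A, mul_pos hM (Real.sqrt_pos.2 hA), fun δ hδ hδ1 => ?_⟩
    exact hK δ A _ hδ hδ1.le hA.le (Real.rpow_nonneg hδ.le _) (hW δ hδ)
  · obtain ⟨C, hC, hb⟩ := hlarge h
    rintro ⟨A, hA⟩
    exact KakeyaGr.not_isBesicovitch_of_kakeyaNormLE hdn.le hC hb A hA
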